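/- **Setting.** Let $\mathcal T$ be a triangulated category with countable coproducts and suspension $\Sigma$ (for example the homotopy category $Ho(\mathcal C)$ of a stable model category), and write $[-,-]$ for its morphism groups. For a simplicial object $C_\bullet$ of $\mathcal T$ let $d^C_n : C_{n+1}\to C_n$ be the alternating sum of the face maps, and put $C_s=0$ for $s<0$. A *totalization* of $C_\bullet$ consists of a tower of skeleta $0=T_{-1}\to T_0\to T_1\to\cdots$ and distinguished triangles $$\Sigma^{s}C_{s+1}\xrightarrow{\;a_s\;}T_s\to T_{s+1}\xrightarrow{\;\pi_{s+1}\;}\Sigma^{s+1}C_{s+1}$$ such that the composite $\pi_s a_s$ is $\Sigma^s d^C_s$, together with a homotopy colimit $\mathrm{Tot}\,C_\bullet$ of the $T_s$. ($C_\bullet$ is *totalizable* if a totalization exists.) For $i\ge 0$ let $T_{[i,j]}$ be a cone of $T_{i-1}\to T_j$; these form a tower $T_{[i,i]}=\Sigma^iC_i\to T_{[i,i+1]}\to\cdots$ with triangles $\Sigma^sC_{s+1}\xrightarrow{a_s}T_{[i,s]}\to T_{[i,s+1]}\to\Sigma^{s+1}C_{s+1}$ compatible with those of the $T_s$. *Toda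 brackets.* Let $C_\bullet$, $D_\bullet$ be simplicial objects with chosen totalizations and let $f_\bullet:C_\bullet\to D_\bullet$ be a simplicial map. For $N\ge 2$ and $i\ge 0$, the bracket $T(N,i;f_\bullet)\subseteq[\Sigma^{N-1}C_{i+N},D_i]$ is the set of all $\tau$ arising as follows, for some choice of the towers $T^C_{[i,\cdot]}$, $T^D_{[i,\cdot]}$ of subquotients: there is a filtration-preserving map $\varphi:T^C_{[i,i+N-1]}\to T^D_{[i,i+N-1]}$ (that is, a family of maps $T^C_{[i,s]}\to T^D_{[i,s]}$, $i\le s\le i+N-1$, which together with the maps $\Sigma^sf_s$ on the subquotients $\Sigma^sC_s\to\Sigma^sD_s$ form maps of the triangles above), and the composite of $\Sigma^i\tau$ with $\Sigma^iD_i\to T^D_{[i,i+N-1]}$ is the difference $$\varphi\circ a^C_{i+N-1}-a^D_{i+N-1}\circ\Sigma^{i+N-1}f_{i+N}:\Sigma^{i+N-1}C_{i+N}\to T^D_{[i,i+N-1]}.$$ The bracket *vanishes* if it contains $0$. **Theorem.** Let $f_\bullet:C_\bullet\to D_\bullet$ be a map of simplicial objects of $\mathcal T$ with given totalizations, and let $S$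 be an object of $\mathcal T$. Let $H$ be either the cohomological functor $H(-)=[-,S]$ or the homological functor $H(-)=[S,-]$. 1. Applying $H$ to the skeletal tower of $C_\bullet$ gives an exact couple and hence a spectral sequence $$E_1^{s,t}\cong H(\Sigma^tC_s)\Longrightarrow H(\Sigma^{t-s}\mathrm{Tot}\,C_\bullet)$$ (zero for $s<0$), in which $d_r$ has bidegree $(r,r-1)$ for $H=[-,S]$ and $(-r,1-r)$ for $H=[S,-]$, and $d_1$ is induced by $\Sigma^td^C$; likewise for $D_\bullet$. Convergence is conditional, in the following sense. For $H=[-,S]$, the groups $H(\Sigma^nT_m)$ vanish for $m<0$ and there are exact sequences $0\to\lim^1_mH(\Sigma^{n+1}T_m)\to H(\Sigma^n\mathrm{Tot}\,C_\bullet)\to\lim_mH(\Sigma^nT_m)\to0$. For $H=[S,-]$, the limit and derived limit of $H(\Sigma^nT_m)$ for $m\to-\infty$ vanish, so that the spectral sequence converges conditionally to $\operatorname{colim}_mH(\Sigma^nT_m)$; and if $S$ is compact (every map from $S$ to a countable coproduct is a finite sum of maps to the summands) the canonical map from this colimit to $H(\Sigma^n\mathrm{Tot}\,C_\bullet)$ is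 an isomorphism. 2. The maps $H(\Sigma^tf_s)$ form a map between the $E_1$-pages of the two spectral sequences that commutes with $d_1$. 3. Let $k>2$ and suppose that the Toda brackets $T(N,i;f_\bullet)$ vanish for all $2\le N<k$ and all $i\ge0$. Then $f_\bullet$ induces maps between the $E_r$-pages of the two spectral sequences for all $1\le r<k$, and these commute with the differentials $d_r$: the map of $E_1$-pages is the one in 2., and for $r+1<k$ the map of $E_{r+1}$-pages is the one that the map of $E_r$-pages induces on homology. The maps in 2. and 3. go from the pages for $C_\bullet$ to those for $D_\bullet$ if $H=[S,-]$, and from the pages for $D_\bullet$ to those for $C_\bullet$ if $H=[-,S]$. -/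

import Mathlib

open CategoryTheory Category Limits Pretriangulated

universe v u

/-- Bookkeeping for a bigraded exact couple.  A position `p = (s, t)` of the first page has a
filtration degree `fil p`; `jdeg p` and `kdeg p` are the total degrees in which the maps
`j : A → E` (into position `p`) and `k : E → A` (out of position `p`) live, and `shift r` is the
bidegree of the differential `d_r`. -/
structure CoupleGrading where
  fil : ℤ × ℤ → ℤ
  jdeg : ℤ × ℤ → ℤ
  kdeg : ℤ × ℤ → ℤ
  shift : ℤ → ℤ × ℤ
  fil_shift : ∀ p r, fil (p + shift r) = fil p + r
  jdeg_shift : ∀ p r, jdeg (p + shift r) = kdeg p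

/-- An (unrolled) exact couple of abelian groups: a decreasing system
`⋯ ⟶ A (σ + 1) ⟶ A σ ⟶ ⋯` and long exact sequences
`⋯ ⟶ A (σ + 1) ⟶ A σ ⟶ E ⟶ A (σ + 1) ⟶ A σ ⟶ ⋯`. -/
structure ExactCouple (g : CoupleGrading) where
  A : ℤ → ℤ → Type v
  E : ℤ × ℤ → Type v
  [instA : ∀ σ n, AddCommGroup (A σ n)]
  [instE : ∀ p, AddCommGroup (E p)]
  i : ∀ {σ σ' : ℤ} (_ : σ ≤ σ') (n : ℤ), A σ' n →+ A σ n
  j : ∀ p, A (g.fil p) (g.jdeg p) →+ E p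
  k : ∀ (p : ℤ × ℤ) {σ n : ℤ} (_ : g.fil p + 1 = σ) (_ : g.kdeg p = n), E p →+ A σ n
  i_refl : ∀ (σ n : ℤ) (a : A σ n), i (le_refl σ) n a = a
  i_trans : ∀ {σ σ' σ'' : ℤ} (h : σ ≤ σ') (h' : σ' ≤ σ'') (n : ℤ) (a : A σ'' n),
    i h n (i h' n a) = i (h.trans h') n a
  exact_E : ∀ (p : ℤ × ℤ) {σ n : ℤ} (hσ : g.fil p + 1 = σ) (hn : g.kdeg p = n),
    Function.Exact (j p) (k p hσ hn)
  exact_j : ∀ (p : ℤ × ℤ) {σ : ℤ} (hσ : g.fil p + 1 = σ),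
    Function.Exact (i (show g.fil p ≤ σ by omega) (g.jdeg p)) (j p)
  exact_k : ∀ (p : ℤ × ℤ) {σ n τ : ℤ} (hσ : g.fil p + 1 = σ) (hn : g.kdeg p = n)
    (hτ : τ = g.fil p), Function.Exact (k p hσ hn) (i (show τ ≤ σ by omega) n)

attribute [instance] ExactCouple.instA ExactCouple.instE

namespace ExactCouple

variable {g : CoupleGrading} (X : ExactCouple.{v} g)

/-- The group `Z_r` of `r`-cycles: the `x` such that `k x` lifts `r - 1` steps up the system. -/
def cycles (r : ℤ) (hr : 1 ≤ r) (p : ℤ × ℤ) : AddSubgroup (X.E p) where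
  carrier := {x | ∃ (σ n : ℤ) (hσ : g.fil p + r = σ) (hn : g.kdeg p = n) (a : X.A σ n),
    X.i (show g.fil p + 1 ≤ σ by omega) n a = X.k p rfl hn x}
  zero_mem' := ⟨_, _, rfl, rfl, 0, by simp⟩
  add_mem' := by
    rintro x y ⟨_, _, rfl, rfl, a, ha⟩ ⟨_, _, rfl, rfl, b, hb⟩
    exact ⟨_, _, rfl, rfl, a + b, by simp [ha, hb]⟩
  neg_mem' := by
    rintro x ⟨_, _, rfl, rfl, a, ha⟩
    exact ⟨_, _, rfl, rfl, -a, by simp [ha]⟩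

/-- The group `B_r` of `r`-boundaries: the `j a` such that `a` dies `r - 1` steps down. -/
def boundaries (r : ℤ) (hr : 1 ≤ r) (p : ℤ × ℤ) : AddSubgroup (X.E p) :=
  (X.i (show g.fil p - (r - 1) ≤ g.fil p by omega) (g.jdeg p)).ker.map (X.j p)

lemma j_mem_cycles (r : ℤ) (hr : 1 ≤ r) (p : ℤ × ℤ) (a : X.A (g.fil p) (g.jdeg p)) :
    X.j p a ∈ X.cycles r hr p :=
  ⟨_, _, rfl, rfl, 0, by simp [((X.exact_E p rfl rfl) _).2 ⟨a, rfl⟩]⟩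

/-- The entry `E_r = Z_r / B_r` of the `r`-th page. -/
abbrev Page (r : ℤ) (hr : 1 ≤ r) (p : ℤ × ℤ) : Type v :=
  X.cycles r hr p ⧸ (X.boundaries r hr p).addSubgroupOf (X.cycles r hr p)

/-- The class in `E_r` of an `r`-cycle. -/
def toPage (r : ℤ) (hr : 1 ≤ r) (p : ℤ × ℤ) : X.cycles r hr p →+ X.Page r hr p :=
  QuotientAddGroup.mk' _

lemma toPage_surjective (r : ℤ) (hr : 1 ≤ r) (p : ℤ × ℤ) :
    Function.Surjective (X.toPage r hr p) := QuotientAddGroup.mk'_surjective _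

lemma toPage_eq_zero_iff (r : ℤ) (hr : 1 ≤ r) (p : ℤ × ℤ) (x : X.cycles r hr p) :
    X.toPage r hr p x = 0 ↔ (x : X.E p) ∈ X.boundaries r hr p := by
  rw [toPage, QuotientAddGroup.mk'_apply, QuotientAddGroup.eq_zero_iff,
    AddSubgroup.mem_addSubgroupOf]

/-- `y` represents `d_r x`: there is a lift `a` of `k x` with `j a = y`. -/
def DiffRel (r : ℤ) (hr : 1 ≤ r) {p q : ℤ × ℤ} (h : p + g.shift r = q)
    (x : X.E p) (y : X.E q) : Prop :=
  ∃ a : X.A (g.fil q) (g.jdeg q),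
    X.i (show g.fil p + 1 ≤ g.fil q by rw [← h, g.fil_shift]; omega) _ a =
      X.k p rfl (by rw [← h, g.jdeg_shift]) x ∧ X.j q a = y

section

variable (r : ℤ) (hr : 1 ≤ r) {p q : ℤ × ℤ} (h : p + g.shift r = q)

lemma exists_diffRel_iff (x : X.E p) :
    (∃ y, X.DiffRel r hr h x y) ↔ x ∈ X.cycles r hr p := by
  constructor
  · rintro ⟨y, a, ha, -⟩
    exact ⟨_, _, by rw [← h, g.fil_shift], by rw [← h, g.jdeg_shift], a, ha⟩
  · rintro ⟨σ, n, hσ, hn, a, ha⟩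
    obtain rfl : g.fil q = σ := by rw [← h, g.fil_shift, hσ]
    obtain rfl : g.jdeg q = n := by rw [← h, g.jdeg_shift, hn]
    exact ⟨X.j q a, a, ha, rfl⟩

variable {r hr h}

lemma DiffRel.mem_cycles {x : X.E p} {y : X.E q} (H : X.DiffRel r hr h x y) (r' : ℤ)
    (hr' : 1 ≤ r') : y ∈ X.cycles r' hr' q := by
  obtain ⟨a, -, rfl⟩ := H
  exact X.j_mem_cycles r' hr' q a

lemma DiffRel.add {x x' : X.E p} {y y' : X.E q} (H : X.DiffRel r hr h x y)
    (H' : X.DiffRel r hr h x' y') : X.DiffRel r hr h (x + x') (y + y') := by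
  obtain ⟨a, ha, rfl⟩ := H
  obtain ⟨b, hb, rfl⟩ := H'
  exact ⟨a + b, by simp [ha, hb], by simp⟩

lemma DiffRel.sub {x x' : X.E p} {y y' : X.E q} (H : X.DiffRel r hr h x y)
    (H' : X.DiffRel r hr h x' y') : X.DiffRel r hr h (x - x') (y - y') := by
  obtain ⟨a, ha, rfl⟩ := H
  obtain ⟨b, hb, rfl⟩ := H'
  exact ⟨a - b, by simp [ha, hb], by simp⟩

variable (r hr h)

lemma diffRel_zero_iff (y : X.E q) :
    X.DiffRel r hr h 0 y ↔ y ∈ X.boundaries r hr q := by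
  have e : g.fil p + 1 = g.fil q - (r - 1) := by rw [← h, g.fil_shift]; omega
  simp only [DiffRel, boundaries, AddSubgroup.mem_map, AddMonoidHom.mem_ker, map_zero]
  constructor
  · rintro ⟨a, ha, rfl⟩
    refine ⟨a, ?_, rfl⟩
    rw [← X.i_trans (show g.fil q - (r - 1) ≤ g.fil p + 1 by omega) (by omega), ha, map_zero]
  · rintro ⟨a, ha, rfl⟩
    refine ⟨a, ?_, rfl⟩
    rw [← X.i_trans (show g.fil p + 1 ≤ g.fil q - (r - 1) by omega) (by omega), ha, map_zero]

lemma diffRel_boundary {x : X.E p} (hx : x ∈ X.boundaries r hr p) : X.DiffRel r hr h x 0 := by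
  obtain ⟨a, -, rfl⟩ := hx
  have e : g.kdeg p = g.jdeg q := by rw [← h, g.jdeg_shift]
  exact ⟨0, by simp [((X.exact_E p rfl e) _).2 ⟨a, rfl⟩], by simp⟩

/-- `d_r` vanishes on an `r`-cycle exactly if it is an `(r + 1)`-cycle. -/
lemma diffRel_boundary_iff {x : X.E p} {y : X.E q} (H : X.DiffRel r hr h x y) :
    y ∈ X.boundaries r hr q ↔ x ∈ X.cycles (r + 1) (by omega) p := by
  have e : g.fil q = g.fil p + r := by rw [← h, g.fil_shift]
  have e' : g.kdeg p = g.jdeg q := by rw [← h, g.jdeg_shift]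
  obtain ⟨a, ha, rfl⟩ := H
  constructor
  · rintro ⟨b, hb, hab⟩
    obtain ⟨c, hc⟩ := ((X.exact_j q rfl) (a - b)).1 (by simp [hab])
    refine ⟨_, _, by omega, e', c, ?_⟩
    have hb' : X.i (show g.fil p + 1 ≤ g.fil q by omega) _ b = 0 := by
      rw [← X.i_trans (show g.fil p + 1 ≤ g.fil q - (r - 1) by omega) (by omega),
        AddMonoidHom.mem_ker.1 hb, map_zero]
    rw [← X.i_trans (show g.fil p + 1 ≤ g.fil q by omega) (by omega), hc, map_sub, hb', sub_zero,
      ha]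
  · rintro ⟨σ, n, hσ, hn, c, hc⟩
    obtain rfl : n = g.jdeg q := by omega
    refine ⟨a - X.i (by omega) _ c, ?_, ?_⟩
    · rw [SetLike.mem_coe, AddMonoidHom.mem_ker, ← X.i_trans (show g.fil q - (r - 1) ≤ g.fil p + 1 by omega)
        (by omega), map_sub, ha, X.i_trans, hc, sub_self, map_zero]
    · rw [map_sub, ((X.exact_j q (show g.fil q + 1 = σ by omega)) _).2 ⟨c, rfl⟩, sub_zero]

/-- The elements hit by `d_r` are the `(r + 1)`-boundaries. -/
lemma exists_diffRel_iff_mem_boundaries (y : X.E q) :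
    (∃ x : X.E p, X.DiffRel r hr h x y) ↔ y ∈ X.boundaries (r + 1) (by omega) q := by
  have e : g.fil q = g.fil p + r := by rw [← h, g.fil_shift]
  have e' : g.kdeg p = g.jdeg q := by rw [← h, g.jdeg_shift]
  constructor
  · rintro ⟨x, a, ha, rfl⟩
    refine ⟨a, ?_, rfl⟩
    rw [SetLike.mem_coe, AddMonoidHom.mem_ker, ← X.i_trans (show g.fil q - (r + 1 - 1) ≤ g.fil p + 1 by omega)
      (by omega), ha]
    exact ((X.exact_k p rfl e' (by omega)) _).2 ⟨x, rfl⟩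
  · rintro ⟨a, ha, rfl⟩
    obtain ⟨x, hx⟩ := ((X.exact_k p rfl e' (show g.fil q - (r + 1 - 1) = g.fil p by omega))
      (X.i (by omega) _ a)).1 (by rw [X.i_trans]; exact ha)
    exact ⟨x, a, hx.symm, rfl⟩

/-- A value of `d_r` on an `r`-cycle. -/
noncomputable def diffRep (x : X.cycles r hr p) : X.E q :=
  ((X.exists_diffRel_iff r hr h x.1).2 x.2).choose

lemma diffRep_spec (x : X.cycles r hr p) : X.DiffRel r hr h x.1 (X.diffRep r hr h x) :=
  ((X.exists_diffRel_iff r hr h x.1).2 x.2).choose_spec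

lemma toPage_eq_of_diffRel {x x' : X.E p} {y y' : X.cycles r hr q}
    (H : X.DiffRel r hr h x y.1) (H' : X.DiffRel r hr h x' y'.1)
    (hx : x - x' ∈ X.boundaries r hr p) : X.toPage r hr q y = X.toPage r hr q y' := by
  rw [← sub_eq_zero, ← map_sub, toPage_eq_zero_iff, ← X.diffRel_zero_iff r hr h]
  have := DiffRel.sub X (DiffRel.sub X H H') (X.diffRel_boundary r hr h hx)
  simpa using this

/-- The differential `d_r : E_r → E_r`, sending the class of `x` to the class of `j a`, where
`a` is any lift of `k x`. -/
noncomputable def diff : X.Page r hr p →+ X.Page r hr q :=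
  QuotientAddGroup.lift _
    (AddMonoidHom.mk' (fun x ↦ X.toPage r hr q
      ⟨X.diffRep r hr h x, DiffRel.mem_cycles X (X.diffRep_spec r hr h x) r hr⟩) (by
        intro x x'
        rw [← map_add]
        exact X.toPage_eq_of_diffRel r hr h (X.diffRep_spec r hr h (x + x'))
          (DiffRel.add X (X.diffRep_spec r hr h x) (X.diffRep_spec r hr h x'))
          (by simp)))
    (by
      intro x hx
      rw [AddSubgroup.mem_addSubgroupOf] at hx
      rw [AddMonoidHom.mem_ker, AddMonoidHom.mk'_apply, ← map_zero (X.toPage r hr q)]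
      exact X.toPage_eq_of_diffRel r hr h (X.diffRep_spec r hr h x)
        (X.diffRel_boundary r hr h (x := x.1) hx) (by simp))

lemma diff_toPage (x : X.cycles r hr p) (y : X.cycles r hr q) (H : X.DiffRel r hr h x.1 y.1) :
    X.diff r hr h (X.toPage r hr p x) = X.toPage r hr q y :=
  X.toPage_eq_of_diffRel r hr h (X.diffRep_spec r hr h x) H (by simp)

lemma exists_rep (x : X.cycles r hr p) : ∃ y : X.cycles r hr q, X.DiffRel r hr h x.1 y.1 :=
  ⟨⟨_, DiffRel.mem_cycles X (X.diffRep_spec r hr h x) r hr⟩, X.diffRep_spec r hr h x⟩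

lemma diff_toPage_eq_zero_iff (x : X.cycles r hr p) :
    X.diff r hr h (X.toPage r hr p x) = 0 ↔ x.1 ∈ X.cycles (r + 1) (by omega) p := by
  obtain ⟨y, H⟩ := X.exists_rep r hr h x
  rw [X.diff_toPage r hr h x y H, toPage_eq_zero_iff, X.diffRel_boundary_iff r hr h H]

lemma toPage_mem_range_diff_iff (y : X.cycles r hr q) :
    (∃ x, X.diff r hr h x = X.toPage r hr q y) ↔
      y.1 ∈ X.boundaries (r + 1) (by omega) q := by
  rw [← X.exists_diffRel_iff_mem_boundaries r hr h]
  constructor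
  · rintro ⟨x, hx⟩
    obtain ⟨x, rfl⟩ := X.toPage_surjective r hr p x
    obtain ⟨y', H⟩ := X.exists_rep r hr h x
    rw [X.diff_toPage r hr h x y' H, ← sub_eq_zero, ← map_sub, toPage_eq_zero_iff,
      ← X.diffRel_zero_iff r hr h] at hx
    exact ⟨x.1, by simpa using DiffRel.sub X H hx⟩
  · rintro ⟨x, H⟩
    exact ⟨X.toPage r hr p ⟨x, (X.exists_diffRel_iff r hr h x).1 ⟨_, H⟩⟩,
      X.diff_toPage r hr h _ _ H⟩

lemma cycles_le : X.cycles (r + 1) (by omega) p ≤ X.cycles r hr p := by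
  intro x hx
  obtain ⟨y, H⟩ : ∃ y, X.DiffRel r hr (rfl : p + g.shift r = _) x y := by
    rw [exists_diffRel_iff]
    obtain ⟨_, _, rfl, rfl, a, ha⟩ := hx
    exact ⟨_, _, rfl, rfl, X.i (by omega) _ a, by rw [X.i_trans, ha]⟩
  exact (X.exists_diffRel_iff r hr _ x).1 ⟨y, H⟩

lemma boundaries_le_cycles (r' : ℤ) (hr' : 1 ≤ r') :
    X.boundaries r hr p ≤ X.cycles r' hr' p := by
  rintro _ ⟨a, -, rfl⟩
  exact X.j_mem_cycles r' hr' p a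

end

/-- The `r`-th page of the spectral sequence of an exact couple. -/
noncomputable def page (r : ℤ) (hr : 1 ≤ r) :
    HomologicalComplex AddCommGrpCat.{v} (ComplexShape.up' (g.shift r)) where
  X p := AddCommGrpCat.of (X.Page r hr p)
  d p q := if h : p + g.shift r = q then AddCommGrpCat.ofHom (X.diff r hr h) else 0
  shape p q h := dif_neg h
  d_comp_d' p q q' h h' := by
    rw [dif_pos (show p + g.shift r = q from h), dif_pos (show q + g.shift r = q' from h')]
    refine AddCommGrpCat.hom_ext (AddMonoidHom.ext fun x ↦ ?_)
    obtain ⟨x, rfl⟩ := X.toPage_surjective r hr p x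
    obtain ⟨y, H⟩ := X.exists_rep r hr h x
    change X.diff r hr h' (X.diff r hr h (X.toPage r hr p x)) = 0
    rw [X.diff_toPage r hr h x y H]
    exact (X.diff_toPage_eq_zero_iff r hr h' y).2 (DiffRel.mem_cycles X H _ _)

lemma page_d_apply (r : ℤ) (hr : 1 ≤ r) {p q : ℤ × ℤ} (h : p + g.shift r = q)
    (x : X.Page r hr p) : ((X.page r hr).d p q).hom x = X.diff r hr h x := by
  simp only [page, dif_pos h]
  rfl

section

variable (r r' : ℤ) (hr : 1 ≤ r) (hrr' : r + 1 = r') (p : ℤ × ℤ)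

/-- The map from `(r + 1)`-cycles to the homology of the `r`-th page. -/
noncomputable def cyclesToHomology :
    X.cycles r' (by omega) p →+
      (((X.page r hr).sc p).g.hom.ker ⧸ ((X.page r hr).sc p).abToCycles.range) :=
  (QuotientAddGroup.mk' _).comp
    (((X.toPage r hr p).comp (AddSubgroup.inclusion (by subst hrr'; exact X.cycles_le r hr))).codRestrict
      ((X.page r hr).sc p).g.hom.ker (by
        intro x
        have hn : p + g.shift r = (ComplexShape.up' (g.shift r)).next p :=
          ((ComplexShape.up' (g.shift r)).next_eq' rfl).symm
        refine (X.page_d_apply r hr hn _).trans ?_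
        subst hrr'
        exact (X.diff_toPage_eq_zero_iff r hr hn _).2 x.2))

lemma cyclesToHomology_surjective :
    Function.Surjective (X.cyclesToHomology r r' hr hrr' p) := by
  subst hrr'
  intro y
  obtain ⟨⟨y, hy⟩, rfl⟩ := QuotientAddGroup.mk'_surjective _ y
  obtain ⟨x, rfl⟩ := X.toPage_surjective r hr p y
  have hn : p + g.shift r = (ComplexShape.up' (g.shift r)).next p :=
    ((ComplexShape.up' (g.shift r)).next_eq' rfl).symm
  have hx := (X.diff_toPage_eq_zero_iff r hr hn x).1
    ((X.page_d_apply r hr hn _).symm.trans hy)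
  exact ⟨⟨x.1, hx⟩, rfl⟩

lemma cyclesToHomology_ker :
    (X.cyclesToHomology r r' hr hrr' p).ker =
      (X.boundaries r' (by omega) p).addSubgroupOf (X.cycles r' (by omega) p) := by
  subst hrr'
  ext x
  have hp : (p - g.shift r) + g.shift r = p := sub_add_cancel _ _
  have hp' : (ComplexShape.up' (g.shift r)).prev p = p - g.shift r :=
    (ComplexShape.up' (g.shift r)).prev_eq' hp
  have hprev : (ComplexShape.up' (g.shift r)).prev p + g.shift r = p := by rw [hp', hp]
  rw [AddMonoidHom.mem_ker, AddSubgroup.mem_addSubgroupOf]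
  have := X.toPage_mem_range_diff_iff r hr hprev ⟨x.1, X.cycles_le r hr x.2⟩
  refine Iff.trans ?_ this
  refine (QuotientAddGroup.eq_zero_iff _).trans ?_
  constructor
  · rintro ⟨z, hz⟩
    exact ⟨z, (X.page_d_apply r hr hprev z).symm.trans (congrArg Subtype.val hz)⟩
  · rintro ⟨z, hz⟩
    exact ⟨z, Subtype.ext ((X.page_d_apply r hr hprev z).trans hz)⟩

/-- The homology of `E_r` is `E_{r+1}`; on representatives this is the identity. -/
noncomputable def pageEquiv :
    X.Page r' (by omega) p ≃+
      (((X.page r hr).sc p).g.hom.ker ⧸ ((X.page r hr).sc p).abToCycles.range) :=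
  (QuotientAddGroup.quotientAddEquivOfEq (X.cyclesToHomology_ker r r' hr hrr' p).symm).trans
    (QuotientAddGroup.quotientKerEquivOfSurjective _
      (X.cyclesToHomology_surjective r r' hr hrr' p))

end

/-- The spectral sequence of an exact couple. -/
noncomputable def spectralSequence :
    SpectralSequence AddCommGrpCat.{v} (fun r ↦ ComplexShape.up' (g.shift r)) 1 where
  page r hr := X.page r hr
  iso r r' p hrr' hr := ((X.page r hr).sc p).abHomologyIso ≪≫
    (X.pageEquiv r r' hr hrr' p).symm.toAddCommGrpIso

lemma cycles_one (p : ℤ × ℤ) : X.cycles 1 le_rfl p = ⊤ := by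
  rw [eq_top_iff]
  intro x _
  exact ⟨_, _, rfl, rfl, X.k p rfl rfl x, X.i_refl _ _ _⟩

lemma boundaries_one (p : ℤ × ℤ) : X.boundaries 1 le_rfl p = ⊥ := by
  rw [eq_bot_iff]
  rintro _ ⟨a, ha, rfl⟩
  have : a = 0 := by
    rw [← X.i_refl _ _ a, ← X.i_trans (show g.fil p ≤ g.fil p - (1 - 1) by omega) (by omega),
      AddMonoidHom.mem_ker.1 ha, map_zero]
  simp [this]

/-- The first page consists of the groups `E p`. -/
noncomputable def pageOneEquiv (p : ℤ × ℤ) : X.E p ≃+ X.Page 1 le_rfl p :=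
  AddEquiv.ofBijective
    ((X.toPage 1 le_rfl p).comp
      ((AddMonoidHom.id (X.E p)).codRestrict (X.cycles 1 le_rfl p)
        (fun x ↦ by simp [X.cycles_one p])))
    ⟨by
      rw [injective_iff_map_eq_zero]
      intro x hx
      have := (X.toPage_eq_zero_iff 1 le_rfl p _).1 hx
      rw [X.boundaries_one p] at this
      exact this,
    by
      intro y
      obtain ⟨x, rfl⟩ := X.toPage_surjective 1 le_rfl p y
      exact ⟨x.1, rfl⟩⟩

/-- The first page consists of the groups `E p`, as an isomorphism. -/
noncomputable def pageOneIso (p : ℤ × ℤ) :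
    AddCommGrpCat.of (X.E p) ≅ (X.spectralSequence.page 1).X p :=
  AddEquiv.toAddCommGrpIso (X := AddCommGrpCat.of (X.E p))
    (Y := AddCommGrpCat.of (X.Page 1 le_rfl p)) (X.pageOneEquiv p)

/-- The difference map `(a_m) ↦ (a_m - i a_{m+1})` of the system `A`, whose kernel is the limit
of the system and whose cokernel is its first derived limit. -/
def limDiff (n : ℤ) : (∀ m : ℕ, X.A m n) →+ (∀ m : ℕ, X.A m n) where
  toFun a m := a m - X.i (show (m : ℤ) ≤ ((m + 1 : ℕ) : ℤ) by omega) n (a (m + 1))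
  map_zero' := by ext; simp
  map_add' a b := by ext; simp [add_sub_add_comm]

/-- The derived limit `lim¹` of the system `⋯ ⟶ A 2 ⟶ A 1 ⟶ A 0` in total degree `n`. -/
abbrev LimOne (n : ℤ) : Type v := (∀ m : ℕ, X.A m n) ⧸ (X.limDiff n).range

/-- Conditional convergence to the limit, with abutment `G`: the system `A` has zero colimit, and
`G n` is related to it by the exact sequence `0 ⟶ lim¹ A (n + 1) ⟶ G n ⟶ lim A n ⟶ 0`, whose
second map has the components `ρ`. -/
structure ConvergesConditionallyToLimit (G : ℤ → Type v) [∀ n, AddCommGroup (G n)]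
    (ρ : ∀ σ n, G n →+ X.A σ n) : Prop where
  colim_eq_zero : ∀ (σ n : ℤ) (a : X.A σ n), ∃ (σ' : ℤ) (h : σ' ≤ σ), X.i h n a = 0
  compat : ∀ {σ σ' : ℤ} (h : σ ≤ σ') (n : ℤ) (x : G n), X.i h n (ρ σ' n x) = ρ σ n x
  lim_surjective : ∀ (n : ℤ) (a : ∀ m : ℕ, X.A m n), X.limDiff n a = 0 →
    ∃ x : G n, ∀ m : ℕ, ρ m n x = a m
  ker_eq_limOne : ∀ n : ℤ, ∃ l : X.LimOne (n + 1) →+ G n, Function.Injective l ∧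
    ∀ x : G n, x ∈ l.range ↔ ∀ m : ℕ, ρ m n x = 0

/-- Conditional convergence to the colimit: the limit and the derived limit of the system `A`
vanish. -/
structure ConvergesConditionallyToColimit : Prop where
  lim_eq_zero : ∀ n, Function.Injective (X.limDiff n)
  limOne_eq_zero : ∀ n, Function.Surjective (X.limDiff n)

/-- `G` is the colimit of the system `A` (along `σ → -∞`) via the maps `ρ`. -/
structure IsColimit (G : ℤ → Type v) [∀ n, AddCommGroup (G n)]
    (ρ : ∀ σ n, X.A σ n →+ G n) : Prop where
  compat : ∀ {σ σ' : ℤ} (h : σ ≤ σ') (n : ℤ) (a : X.A σ' n), ρ σ n (X.i h n a) = ρ σ' n a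
  surjective : ∀ (n : ℤ) (x : G n), ∃ (σ : ℤ) (a : X.A σ n), ρ σ n a = x
  injective : ∀ (σ n : ℤ) (a : X.A σ n), ρ σ n a = 0 → ∃ (σ' : ℤ) (h : σ' ≤ σ), X.i h n a = 0

end ExactCouple

section Triangulated

open scoped Simplicial

variable {𝒯 : Type u} [Category.{v} 𝒯] [Preadditive 𝒯]

section AltComplex

variable [HasZeroObject 𝒯]

open scoped ZeroObject

/-- The alternating sum complex `C_*` of a simplicial object, extended by zero to negative
degrees. -/
noncomputable def altComplex (C : SimplicialObject 𝒯) : ChainComplex 𝒯 ℤ where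
  X s := match s with
    | Int.ofNat n => C _⦋n⦌
    | Int.negSucc _ => 0
  d s s' := match s, s' with
    | Int.ofNat n, Int.ofNat m => (AlgebraicTopology.AlternatingFaceMapComplex.obj C).d n m
    | Int.ofNat _, Int.negSucc _ => 0
    | Int.negSucc _, _ => 0
  shape s s' h := by
    match s, s' with
    | Int.ofNat n, Int.ofNat m =>
      refine (AlgebraicTopology.AlternatingFaceMapComplex.obj C).shape n m (fun h' ↦ h ?_)
      simp only [ComplexShape.down_Rel] at h' ⊢
      simpa using congrArg (Nat.cast : ℕ → ℤ) h'
    | Int.ofNat _, Int.negSucc _ => rfl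
    | Int.negSucc _, _ => rfl
  d_comp_d' s s' s'' _ _ := by
    match s, s', s'' with
    | Int.ofNat n, Int.ofNat m, Int.ofNat l =>
      exact (AlgebraicTopology.AlternatingFaceMapComplex.obj C).d_comp_d n m l
    | Int.ofNat _, Int.ofNat _, Int.negSucc _ => exact comp_zero
    | Int.ofNat _, Int.negSucc _, _ => exact zero_comp
    | Int.negSucc _, _, _ => exact zero_comp

/-- The components of a simplicial map on the (extended) alternating sum complexes. -/
noncomputable def altMap {C D : SimplicialObject 𝒯} (f : C ⟶ D) :
    ∀ s : ℤ, (altComplex C).X s ⟶ (altComplex D).X s := fun s ↦ match s with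
  | Int.ofNat n => f.app (Opposite.op ⦋n⦌)
  | Int.negSucc _ => 0

end AltComplex

variable [HasZeroObject 𝒯] [HasShift 𝒯 ℤ] [∀ n : ℤ, (shiftFunctor 𝒯 n).Additive]
  [Pretriangulated 𝒯]

section Exactness

variable {P Q R S : 𝒯} {f : P ⟶ Q} {g : Q ⟶ R} {h : R ⟶ P⟦(1 : ℤ)⟧}

lemma yoneda_exact_shift (hT : Triangle.mk f g h ∈ distTriang 𝒯) (n : ℤ)
    {b : Q⟦n⟧ ⟶ S} (hb : f⟦n⟧' ≫ b = 0) : ∃ c : R⟦n⟧ ⟶ S, g⟦n⟧' ≫ c = b := by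
  obtain ⟨c, hc⟩ : ∃ c : R⟦n⟧ ⟶ S, b = (n.negOnePow • g⟦n⟧') ≫ c :=
    Triangle.yoneda_exact₂ _ (Triangle.shift_distinguished _ hT n) b
      (show (n.negOnePow • f⟦n⟧') ≫ b = 0 by rw [Linear.units_smul_comp, hb, smul_zero])
  exact ⟨n.negOnePow • c, by rw [hc, Linear.units_smul_comp, Linear.comp_units_smul]⟩

lemma coyoneda_exact_shift (hT : Triangle.mk f g h ∈ distTriang 𝒯) (n : ℤ)
    {b : S ⟶ Q⟦n⟧} (hb : b ≫ g⟦n⟧' = 0) : ∃ c : S ⟶ P⟦n⟧, c ≫ f⟦n⟧' = b := by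
  obtain ⟨c, hc⟩ : ∃ c : S ⟶ P⟦n⟧, b = c ≫ (n.negOnePow • f⟦n⟧') :=
    Triangle.coyoneda_exact₂ _ (Triangle.shift_distinguished _ hT n) b
      (show b ≫ (n.negOnePow • g⟦n⟧') = 0 by rw [Linear.comp_units_smul, hb, smul_zero])
  exact ⟨n.negOnePow • c, by rw [hc, Linear.units_smul_comp, Linear.comp_units_smul]⟩

end Exactness

variable [HasCoproductsOfShape ℕ 𝒯]

/-- The map `1 - shift : ∐ T_n ⟶ ∐ T_n` whose cone is the homotopy colimit of the `T_n`,
`n ≥ 0`. -/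
noncomputable def oneSubShift (T : ℤ ⥤ 𝒯) :
    (∐ fun n : ℕ ↦ T.obj n) ⟶ (∐ fun n : ℕ ↦ T.obj n) :=
  Sigma.desc fun n : ℕ ↦ Sigma.ι (fun n : ℕ ↦ T.obj n) n -
    T.map (homOfLE (show (n : ℤ) ≤ ((n + 1 : ℕ) : ℤ) by omega)) ≫
      Sigma.ι (fun n : ℕ ↦ T.obj n) (n + 1)

/-- A totalization of a simplicial object `C` of a triangulated category (such as the homotopy
category of a stable model category): skeleta `0 = T_{-1} ⟶ T_0 ⟶ T_1 ⟶ ⋯`, where `T_{s+1}` is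
the cone of a map `Σ^s C_{s+1} ⟶ T_s` that lifts `Σ^s d : Σ^s C_{s+1} ⟶ Σ^s C_s`, together
with their homotopy colimit. -/
structure Totalization (C : SimplicialObject 𝒯) where
  /-- the skeleton `T_s` -/
  skel : ℤ ⥤ 𝒯
  isZero_skel : ∀ s : ℤ, s < 0 → IsZero (skel.obj s)
  /-- the attaching map `Σ^s C_{s+1} ⟶ T_s` -/
  attach : ∀ (s s' : ℤ) (_ : s + 1 = s'), ((altComplex C).X s')⟦s⟧ ⟶ skel.obj s
  /-- the projection `T_s ⟶ T_s / T_{s-1} = Σ^s C_s` -/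
  proj : ∀ s : ℤ, skel.obj s ⟶ ((altComplex C).X s)⟦s⟧
  attach_proj : ∀ (s s' : ℤ) (h : s + 1 = s'),
    attach s s' h ≫ proj s = ((altComplex C).d s' s)⟦s⟧'
  distinguished : ∀ (s s' : ℤ) (h : s + 1 = s'),
    Triangle.mk (attach s s' h) (skel.map (homOfLE (show s ≤ s' by omega)))
      (proj s' ≫ (shiftFunctorAdd' 𝒯 s 1 s' h).hom.app _) ∈ distTriang 𝒯
  /-- the total object -/
  tot : 𝒯
  /-- the structure map to the homotopy colimit -/
  incl : (∐ fun n : ℕ ↦ skel.obj n) ⟶ tot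
  /-- the connecting map of the homotopy colimit -/
  conn : tot ⟶ (∐ fun n : ℕ ↦ skel.obj n)⟦(1 : ℤ)⟧
  distinguished_tot : Triangle.mk (oneSubShift skel) incl conn ∈ distTriang 𝒯

namespace Totalization

variable {C D : SimplicialObject 𝒯}

/-- The structure map `T_s ⟶ Tot C`. -/
noncomputable def toTot (X : Totalization C) : ∀ s : ℤ, X.skel.obj s ⟶ X.tot := fun s ↦ match s with
  | Int.ofNat n => Sigma.ι (fun n : ℕ ↦ X.skel.obj n) n ≫ X.incl
  | Int.negSucc _ => 0

/-- The tower of subquotients `U_j = T_j / T_{i-1}`, which are the totalizations of the pieces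
`C_j ⟶ ⋯ ⟶ C_i`: each `U_j` is a cone of `T_{i-1} ⟶ T_j`, and `U_{s+1}` is the cone of the
attaching map `Σ^s C_{s+1} ⟶ T_s ⟶ U_s`, compatibly with the triangles of the skeleta (the
compatibilities provided by the octahedral axiom). -/
structure Subquotient (X : Totalization C) (i : ℤ) where
  obj : ℤ ⥤ 𝒯
  isZero_obj : ∀ j : ℤ, j < i → IsZero (obj.obj j)
  /-- the quotient maps `T_j ⟶ T_j / T_{i-1}` -/
  quot : X.skel ⟶ obj
  /-- the connecting maps of the triangles `T_{i-1} ⟶ T_j ⟶ U_j` -/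
  conn : ∀ (j : ℤ) (_ : i ≤ j), obj.obj j ⟶ (X.skel.obj (i - 1))⟦(1 : ℤ)⟧
  distinguished_quot : ∀ (j : ℤ) (h : i ≤ j),
    Triangle.mk (X.skel.map (homOfLE (show i - 1 ≤ j by omega))) (quot.app j) (conn j h) ∈
      distTriang 𝒯
  map_conn : ∀ (j j' : ℤ) (h : i ≤ j) (h' : j ≤ j'),
    obj.map (homOfLE h') ≫ conn j' (h.trans h') = conn j h
  /-- the projection `U_s ⟶ U_s / U_{s-1} = Σ^s C_s` -/
  proj : ∀ (s : ℤ) (_ : i ≤ s), obj.obj s ⟶ ((altComplex C).X s)⟦s⟧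
  quot_proj : ∀ (s : ℤ) (h : i ≤ s), quot.app s ≫ proj s h = X.proj s
  distinguished : ∀ (s s' : ℤ) (h : s + 1 = s') (h' : i ≤ s'),
    Triangle.mk (X.attach s s' h ≫ quot.app s) (obj.map (homOfLE (show s ≤ s' by omega)))
      (proj s' h' ≫ (shiftFunctorAdd' 𝒯 s 1 s' h).hom.app _) ∈ distTriang 𝒯

/-- The attaching map `Σ^s C_{s+1} ⟶ U_s` of the tower of subquotients. -/
noncomputable def Subquotient.attach {X : Totalization C} {i : ℤ} (U : X.Subquotient i) (s s' : ℤ)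
    (h : s + 1 = s') : ((altComplex C).X s')⟦s⟧ ⟶ U.obj.obj s :=
  X.attach s s' h ≫ U.quot.app s

/-- A filtration-preserving map `U_m ⟶ V_m` between the totalizations of the pieces with
simplicial degrees `i, …, m` of `C` and `D` which on the subquotients `Σ^s C_s ⟶ Σ^s D_s` agrees
with the simplicial map `f`. -/
structure FilteredMap {X : Totalization C} {Y : Totalization D} (f : C ⟶ D) {i : ℤ}
    (U : X.Subquotient i) (V : Y.Subquotient i) (m : ℤ) where
  app : ∀ (s : ℤ) (_ : i ≤ s) (_ : s ≤ m), U.obj.obj s ⟶ V.obj.obj s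
  comm_map : ∀ (s s' : ℤ) (h : s + 1 = s') (hs : i ≤ s) (hs' : s' ≤ m),
    U.obj.map (homOfLE (show s ≤ s' by omega)) ≫ app s' (by omega) hs' =
      app s hs (by omega) ≫ V.obj.map (homOfLE (show s ≤ s' by omega))
  comm_proj : ∀ (s : ℤ) (hs : i ≤ s) (hs' : s ≤ m),
    U.proj s hs ≫ (altMap f s)⟦s⟧' = app s hs hs' ≫ V.proj s hs
  comm_attach : ∀ (s s' : ℤ) (h : s + 1 = s') (hs : i ≤ s) (hs' : s' ≤ m),
    U.attach s s' h ≫ app s hs (by omega) = (altMap f s')⟦s⟧' ≫ V.attach s s' h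

/-- The Toda bracket `T(N, i; f)`, a set of maps `Σ^{N-1} C_{i+N} ⟶ D_i`.

A filtration-preserving map `φ` on the pieces with degrees `i, …, i + N - 1` (that is, a choice
of null-homotopies which kill the lower brackets in this range) gives two maps from
`Σ^{i+N-1} C_{i+N}` to the totalization `V_{i+N-1}` of the piece of `D`, through the attaching
map of `C` and through that of `D`.  The bracket consists of the maps `τ` such that `Σ^i τ`,
followed by the inclusion of `Σ^i D_i = V_i`, is the difference of the two. -/
def todaBracket (X : Totalization C) (Y : Totalization D) (f : C ⟶ D) (N : ℕ) (hN : 2 ≤ N)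
    (i : ℕ) : Set ((C _⦋i + N⦌)⟦(N : ℤ) - 1⟧ ⟶ D _⦋i⦌) :=
  {τ | ∃ (U : X.Subquotient i) (V : Y.Subquotient i) (φ : FilteredMap f U V (i + N - 1))
      (θ : ((altComplex C).X ((i + N : ℕ) : ℤ))⟦(i + N - 1 : ℤ)⟧ ⟶ V.obj.obj i),
    θ ≫ V.proj i le_rfl =
      (shiftFunctorAdd' 𝒯 ((N : ℤ) - 1) i (i + N - 1) (by omega)).hom.app (C _⦋i + N⦌) ≫
        τ⟦(i : ℤ)⟧' ∧
    θ ≫ V.obj.map (homOfLE (show (i : ℤ) ≤ i + N - 1 by omega)) =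
      U.attach (i + N - 1) ((i + N : ℕ) : ℤ) (by push_cast; omega) ≫
          φ.app (i + N - 1) (by omega) le_rfl -
        (altMap f ((i + N : ℕ) : ℤ))⟦(i + N - 1 : ℤ)⟧' ≫
          V.attach (i + N - 1) ((i + N : ℕ) : ℤ) (by push_cast; omega)}

/-- The grading of the cohomological spectral sequence: `d_r` has bidegree `(r, r - 1)`. -/
def cohGrading : CoupleGrading where
  fil p := p.1
  jdeg p := p.2 - p.1 + 1
  kdeg p := p.2 - p.1
  shift r := (r, r - 1)
  fil_shift _ _ := rfl
  jdeg_shift p r := by simp; omega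

/-- The grading of the homological spectral sequence: `d^r` has bidegree `(-r, 1 - r)`. -/
def homGrading : CoupleGrading where
  fil p := -p.1
  jdeg p := p.2 - p.1
  kdeg p := p.2 - p.1 + 1
  shift r := (-r, 1 - r)
  fil_shift p r := by simp; omega
  jdeg_shift p r := by simp; omega

section Maps

variable (X : Totalization C)

/-- The map `Σ^t C_{s'} ⟶ Σ^n T_s` given by the attaching map, for `s' = s + 1`, `t = s + n`. -/
noncomputable def attachShift (s s' n t : ℤ) (h : s + 1 = s') (ht : s + n = t) :
    ((altComplex C).X s')⟦t⟧ ⟶ (X.skel.obj s)⟦n⟧ :=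
  (shiftFunctorAdd' 𝒯 s n t ht).hom.app _ ≫ (X.attach s s' h)⟦n⟧'

/-- The map `Σ^n T_s ⟶ Σ^t C_{s'}` given by the projection, for `s' = s`, `t = s + n`. -/
noncomputable def projShift (s s' n t : ℤ) (h : s = s') (ht : s' + n = t) :
    (X.skel.obj s)⟦n⟧ ⟶ ((altComplex C).X s')⟦t⟧ :=
  (X.skel.map (homOfLE h.le) ≫ X.proj s')⟦n⟧' ≫ (shiftFunctorAdd' 𝒯 s' n t ht).inv.app _

/-- The map `Σ^n T_s ⟶ Σ^n T_{s'}`. -/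
noncomputable def skelShift {s s' : ℤ} (h : s ≤ s') (n : ℤ) :
    (X.skel.obj s)⟦n⟧ ⟶ (X.skel.obj s')⟦n⟧ := (X.skel.map (homOfLE h))⟦n⟧'

variable {X}

lemma projShift_eq (s n t : ℤ) (ht : s + n = t) :
    X.projShift s s n t rfl ht = (X.proj s)⟦n⟧' ≫ (shiftFunctorAdd' 𝒯 s n t ht).inv.app _ := by
  simp [projShift]

lemma attach_skel (s s' n t : ℤ) (h : s + 1 = s') (ht : s + n = t) :
    X.attachShift s s' n t h ht ≫ X.skelShift (show s ≤ s' by omega) n = 0 := by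
  have : X.attach s s' h ≫ X.skel.map (homOfLE (show s ≤ s' by omega)) = 0 :=
    comp_distTriang_mor_zero₁₂ _ (X.distinguished s s' h)
  rw [attachShift, skelShift, assoc, ← Functor.map_comp, this, Functor.map_zero, comp_zero]

lemma skel_proj (s s' n t : ℤ) (h : s + 1 = s') (ht : s' + n = t) :
    X.skelShift (show s ≤ s' by omega) n ≫ X.projShift s' s' n t rfl ht = 0 := by
  have : X.skel.map (homOfLE (show s ≤ s' by omega)) ≫
      X.proj s' ≫ (shiftFunctorAdd' 𝒯 s 1 s' h).hom.app _ = 0 :=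
    comp_distTriang_mor_zero₂₃ _ (X.distinguished s s' h)
  rw [← assoc, ← cancel_mono ((shiftFunctorAdd' 𝒯 s 1 s' h).inv.app _), assoc, assoc,
    Iso.hom_inv_id_app, zero_comp, comp_id] at this
  rw [projShift_eq, skelShift, ← Functor.map_comp_assoc, this, Functor.map_zero, zero_comp]

lemma proj_attach_aux (s s' n n' t : ℤ) (h : s + 1 = s') (ht : s' + n = t) (hn : n + 1 = n') :
    X.projShift s' s' n t rfl ht ≫ X.attachShift s s' n' t h (by omega) ≫
        (shiftFunctorAdd' 𝒯 1 n n' (by omega)).hom.app _ =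
      (X.proj s' ≫ (shiftFunctorAdd' 𝒯 s 1 s' h).hom.app _)⟦n⟧' ≫
        ((X.attach s s' h)⟦(1 : ℤ)⟧')⟦n⟧' := by
  have := shiftFunctorAdd'_assoc_hom_app s 1 n s' n' t h (by omega) (by omega)
    ((altComplex C).X s')
  rw [projShift_eq, attachShift, assoc, assoc, NatTrans.naturality]
  dsimp
  rw [← reassoc_of% this, Iso.inv_hom_id_app_assoc]
  simp

lemma proj_attach (s s' n n' t : ℤ) (h : s + 1 = s') (ht : s' + n = t) (hn : n + 1 = n') :
    X.projShift s' s' n t rfl ht ≫ X.attachShift s s' n' t h (by omega) = 0 := by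
  rw [← cancel_mono ((shiftFunctorAdd' 𝒯 1 n n' (by omega)).hom.app _), assoc,
    proj_attach_aux s s' n n' t h ht hn, ← Functor.map_comp]
  have : (X.proj s' ≫ (shiftFunctorAdd' 𝒯 s 1 s' h).hom.app _) ≫ (X.attach s s' h)⟦(1 : ℤ)⟧' = 0 :=
    comp_distTriang_mor_zero₃₁ _ (X.distinguished s s' h)
  rw [this, Functor.map_zero, zero_comp]

lemma shift_aux (s s' n n' t : ℤ) (h : s + 1 = s') (ht : s' + n = t) (hn : n + 1 = n') :
    X.attachShift s s' n' t h (by omega) ≫ (shiftFunctorAdd' 𝒯 1 n n' (by omega)).hom.app _ =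
      (shiftFunctorAdd' 𝒯 s' n t ht).hom.app _ ≫
        ((shiftFunctorAdd' 𝒯 s 1 s' h).hom.app _)⟦n⟧' ≫ ((X.attach s s' h)⟦(1 : ℤ)⟧')⟦n⟧' := by
  have := shiftFunctorAdd'_assoc_hom_app s 1 n s' n' t h (by omega) (by omega)
    ((altComplex C).X s')
  rw [attachShift, assoc, NatTrans.naturality]
  dsimp
  rw [← reassoc_of% this]

variable {S : 𝒯}

lemma yoneda_exact_attach (s r s' n t : ℤ) (h : s + 1 = s') (ht : s + n = t) (hr : r = s')
    (b : (X.skel.obj s)⟦n⟧ ⟶ S) :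
    X.attachShift s s' n t h ht ≫ b = 0 ↔
      ∃ c : (X.skel.obj r)⟦n⟧ ⟶ S, X.skelShift (show s ≤ r by omega) n ≫ c = b := by
  subst hr
  constructor
  · intro hb
    rw [attachShift, assoc, Preadditive.IsIso.comp_left_eq_zero] at hb
    exact yoneda_exact_shift (X.distinguished s r h) n hb
  · rintro ⟨c, rfl⟩
    rw [← assoc, attach_skel, zero_comp]

lemma yoneda_exact_skel (s r s' n t : ℤ) (h : s + 1 = s') (ht : s' + n = t) (hr : r = s')
    (c : (X.skel.obj r)⟦n⟧ ⟶ S) :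
    X.skelShift (show s ≤ r by omega) n ≫ c = 0 ↔
      ∃ x : ((altComplex C).X s')⟦t⟧ ⟶ S, X.projShift r s' n t hr ht ≫ x = c := by
  subst hr
  constructor
  · intro hc
    obtain ⟨x, hx⟩ : ∃ x, (X.proj r ≫ (shiftFunctorAdd' 𝒯 s 1 r h).hom.app _)⟦n⟧' ≫ x = c :=
      yoneda_exact_shift (rot_of_distTriang _ (X.distinguished s r h)) n hc
    refine ⟨(shiftFunctorAdd' 𝒯 r n t ht).hom.app _ ≫
      ((shiftFunctorAdd' 𝒯 s 1 r h).hom.app _)⟦n⟧' ≫ x, ?_⟩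
    rw [← hx, projShift_eq]
    simp
  · rintro ⟨x, rfl⟩
    rw [← assoc, skel_proj s r n t h, zero_comp]

lemma yoneda_exact_proj (s r s' n n' t : ℤ) (h : s + 1 = s') (ht : s' + n = t)
    (hn : n + 1 = n') (hr : r = s') (x : ((altComplex C).X s')⟦t⟧ ⟶ S) :
    X.projShift r s' n t hr ht ≫ x = 0 ↔
      ∃ b : (X.skel.obj s)⟦n'⟧ ⟶ S, X.attachShift s s' n' t h (by omega) ≫ b = x := by
  subst hr
  constructor
  · intro hx
    obtain ⟨e, he⟩ : ∃ e : ((X.skel.obj s)⟦(1 : ℤ)⟧)⟦n⟧ ⟶ S,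
        (-((X.attach s r h)⟦(1 : ℤ)⟧'))⟦n⟧' ≫ e =
          ((shiftFunctorAdd' 𝒯 s 1 r h).inv.app _)⟦n⟧' ≫
            (shiftFunctorAdd' 𝒯 r n t ht).inv.app _ ≫ x := by
      refine yoneda_exact_shift
        (rot_of_distTriang _ (rot_of_distTriang _ (X.distinguished s r h))) n ?_
      change (X.proj r ≫ (shiftFunctorAdd' 𝒯 s 1 r h).hom.app _)⟦n⟧' ≫ _ = 0
      rw [projShift_eq, assoc] at hx
      rw [← Functor.map_comp_assoc, assoc, Iso.hom_inv_id_app, comp_id, hx]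
    refine ⟨-((shiftFunctorAdd' 𝒯 1 n n' (by omega)).hom.app _ ≫ e), ?_⟩
    rw [Functor.map_neg, Preadditive.neg_comp] at he
    rw [Preadditive.comp_neg, ← assoc, shift_aux s r n n' t h ht hn, assoc, assoc,
      ← Preadditive.comp_neg, ← Preadditive.comp_neg, he, ← Functor.map_comp_assoc,
      Iso.hom_inv_id_app]
    rw [CategoryTheory.Functor.map_id, id_comp, Iso.hom_inv_id_app_assoc]
  · rintro ⟨b, rfl⟩
    rw [← assoc, proj_attach s r n n' t h ht hn, zero_comp]

lemma coyoneda_exact_attach (s r s' n t : ℤ) (h : s + 1 = s') (ht : s + n = t) (hr : r = s')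
    (b : S ⟶ (X.skel.obj s)⟦n⟧) :
    b ≫ X.skelShift (show s ≤ r by omega) n = 0 ↔
      ∃ x : S ⟶ ((altComplex C).X s')⟦t⟧, x ≫ X.attachShift s s' n t h ht = b := by
  subst hr
  constructor
  · intro hb
    obtain ⟨x, hx⟩ := coyoneda_exact_shift (X.distinguished s r h) n hb
    exact ⟨x ≫ (shiftFunctorAdd' 𝒯 s n t ht).inv.app _, by simp [attachShift, hx]⟩
  · rintro ⟨x, rfl⟩
    rw [assoc, attach_skel, comp_zero]

lemma coyoneda_exact_skel (s r s' n t : ℤ) (h : s + 1 = s') (ht : s' + n = t) (hr : r = s')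
    (c : S ⟶ (X.skel.obj r)⟦n⟧) :
    c ≫ X.projShift r s' n t hr ht = 0 ↔
      ∃ b : S ⟶ (X.skel.obj s)⟦n⟧, b ≫ X.skelShift (show s ≤ r by omega) n = c := by
  subst hr
  constructor
  · intro hc
    rw [projShift_eq, ← assoc, Preadditive.IsIso.comp_right_eq_zero] at hc
    exact coyoneda_exact_shift (rot_of_distTriang _ (X.distinguished s r h)) n
      (show c ≫ (X.proj r ≫ (shiftFunctorAdd' 𝒯 s 1 r h).hom.app _)⟦n⟧' = 0 by
        rw [Functor.map_comp, reassoc_of% hc, zero_comp])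
  · rintro ⟨b, rfl⟩
    rw [assoc, skel_proj s r n t h, comp_zero]

lemma coyoneda_exact_proj (s r s' n n' t : ℤ) (h : s + 1 = s') (ht : s' + n = t)
    (hn : n + 1 = n') (hr : r = s') (x : S ⟶ ((altComplex C).X s')⟦t⟧) :
    x ≫ X.attachShift s s' n' t h (by omega) = 0 ↔
      ∃ c : S ⟶ (X.skel.obj r)⟦n⟧, c ≫ X.projShift r s' n t hr ht = x := by
  subst hr
  constructor
  · intro hx
    obtain ⟨c, hc⟩ : ∃ c : S ⟶ (X.skel.obj r)⟦n⟧,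
        c ≫ (X.proj r ≫ (shiftFunctorAdd' 𝒯 s 1 r h).hom.app _)⟦n⟧' =
          x ≫ (shiftFunctorAdd' 𝒯 r n t ht).hom.app _ ≫
            ((shiftFunctorAdd' 𝒯 s 1 r h).hom.app _)⟦n⟧' := by
      refine coyoneda_exact_shift
        (rot_of_distTriang _ (rot_of_distTriang _ (X.distinguished s r h))) n ?_
      change _ ≫ (-((X.attach s r h)⟦(1 : ℤ)⟧'))⟦n⟧' = 0
      rw [Functor.map_neg, Preadditive.comp_neg, assoc, assoc, ← shift_aux s r n n' t h ht hn,
        reassoc_of% hx, zero_comp, neg_zero]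
    refine ⟨c, ?_⟩
    rw [projShift_eq, ← cancel_mono ((shiftFunctorAdd' 𝒯 r n t ht).hom.app _),
      ← cancel_mono (((shiftFunctorAdd' 𝒯 s 1 r h).hom.app _)⟦n⟧')]
    simp only [assoc, Iso.inv_hom_id_app_assoc]
    rw [← hc, Functor.map_comp]
  · rintro ⟨c, rfl⟩
    rw [assoc, proj_attach s r n n' t h ht hn, comp_zero]

end Maps

/-- The exact couple obtained from the skeletal tower and the cohomological functor
`H = [-, S]`, with `A σ n = H(Σ^n T_{σ-1})` and `E (s, t) = H(Σ^t C_s)`. -/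
noncomputable def cohCouple (X : Totalization C) (S : 𝒯) : ExactCouple.{v} cohGrading where
  A σ n := (X.skel.obj (σ - 1))⟦n⟧ ⟶ S
  E p := ((altComplex C).X p.1)⟦p.2⟧ ⟶ S
  i h n := Preadditive.leftComp S (X.skelShift (by omega) n)
  j p := Preadditive.leftComp S
    (X.attachShift (p.1 - 1) p.1 (p.2 - p.1 + 1) p.2 (by omega) (by omega))
  k p σ n hσ hn := Preadditive.leftComp S
    (X.projShift (σ - 1) p.1 n p.2 (by dsimp only [cohGrading] at hσ; omega)
      (by dsimp only [cohGrading] at hn; omega))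
  i_refl σ n a := by
    change X.skelShift _ n ≫ a = a
    simp [skelShift]
  i_trans h h' n a := by
    change X.skelShift _ n ≫ X.skelShift _ n ≫ a = X.skelShift _ n ≫ a
    rw [skelShift, skelShift, ← Functor.map_comp_assoc, ← Functor.map_comp]
    rfl
  exact_E p σ n hσ hn x := by
    dsimp only [cohGrading] at hσ hn
    refine yoneda_exact_proj _ _ _ _ _ _ ?_ ?_ ?_ ?_ x
    all_goals first | omega | (dsimp only [cohGrading]; omega)
  exact_j p σ hσ x := by
    dsimp only [cohGrading] at hσ
    refine yoneda_exact_attach _ _ _ _ _ ?_ ?_ ?_ x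
    all_goals omega
  exact_k p σ n τ hσ hn hτ x := by
    dsimp only [cohGrading] at hσ hn hτ
    refine yoneda_exact_skel _ _ _ _ _ ?_ ?_ ?_ x
    all_goals omega

/-- The exact couple obtained from the skeletal tower and the homological functor
`H = [S, -]`, with `A σ n = H(Σ^n T_{-σ})` and `E (s, t) = H(Σ^t C_s)`. -/
noncomputable def homCouple (X : Totalization C) (S : 𝒯) : ExactCouple.{v} homGrading where
  A σ n := S ⟶ (X.skel.obj (-σ))⟦n⟧
  E p := S ⟶ ((altComplex C).X p.1)⟦p.2⟧
  i h n := Preadditive.rightComp S (X.skelShift (by omega) n)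
  j p := Preadditive.rightComp S
    (X.projShift (-(-p.1)) p.1 (p.2 - p.1) p.2 (by omega) (by omega))
  k p σ n hσ hn := Preadditive.rightComp S
    (X.attachShift (-σ) p.1 n p.2 (by dsimp only [homGrading] at hσ; omega)
      (by dsimp only [homGrading] at hσ hn; omega))
  i_refl σ n a := by
    change a ≫ X.skelShift _ n = a
    simp [skelShift]
  i_trans h h' n a := by
    change (a ≫ X.skelShift _ n) ≫ X.skelShift _ n = a ≫ X.skelShift _ n
    rw [skelShift, skelShift, assoc, ← Functor.map_comp, ← Functor.map_comp]
    rfl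
  exact_E p σ n hσ hn x := by
    dsimp only [homGrading] at hσ hn
    refine coyoneda_exact_proj _ _ _ _ _ _ ?_ ?_ ?_ ?_ x
    all_goals first | omega | (dsimp only [homGrading]; omega)
  exact_j p σ hσ x := by
    dsimp only [homGrading] at hσ
    refine coyoneda_exact_skel _ _ _ _ _ ?_ ?_ ?_ x
    all_goals omega
  exact_k p σ n τ hσ hn hτ x := by
    dsimp only [homGrading] at hσ hn hτ
    refine coyoneda_exact_attach _ _ _ _ _ ?_ ?_ ?_ x
    all_goals omega

section SpectralSequences

open AlgebraicTopology.AlternatingFaceMapComplex (objD)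

variable (X : Totalization C) (Y : Totalization D) (f : C ⟶ D) (S : 𝒯)

/-- The cohomological spectral sequence of the skeletal tower, for `H = [-, S]`. -/
noncomputable def cohSS : SpectralSequence AddCommGrpCat.{v}
    (fun r ↦ ComplexShape.up' ((r, r - 1) : ℤ × ℤ)) 1 :=
  (X.cohCouple S).spectralSequence

/-- The homological spectral sequence of the skeletal tower, for `H = [S, -]`. -/
noncomputable def homSS : SpectralSequence AddCommGrpCat.{v}
    (fun r ↦ ComplexShape.up' ((-r, 1 - r) : ℤ × ℤ)) 1 :=
  (X.homCouple S).spectralSequence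

/-- `E_1^{n,t} ≅ [Σ^t C_n, S]`. -/
noncomputable def cohE₁ (n : ℕ) (t : ℤ) :
    AddCommGrpCat.of ((C _⦋n⦌)⟦t⟧ ⟶ S) ≅ ((X.cohSS S).page 1).X ((n : ℤ), t) :=
  (X.cohCouple S).pageOneIso ((n : ℤ), t)

/-- `E^1_{n,t} ≅ [S, Σ^t C_n]`. -/
noncomputable def homE₁ (n : ℕ) (t : ℤ) :
    AddCommGrpCat.of (S ⟶ (C _⦋n⦌)⟦t⟧) ≅ ((X.homSS S).page 1).X ((n : ℤ), t) :=
  (X.homCouple S).pageOneIso ((n : ℤ), t)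

/-- The assertion that `cohSS` is a spectral sequence `E_1^{s,t} = [Σ^t C_s, S]` (zero for
`s < 0`) with `d_1` induced by the alternating sum of the face maps, and that it converges
conditionally to `[Σ^{t-s} Tot C, S]`. -/
structure IsCohSkeletalSS : Prop where
  isZero : ∀ s t : ℤ, s < 0 → IsZero (((X.cohSS S).page 1).X (s, t))
  d_one : ∀ (n : ℕ) (t : ℤ) (x : (C _⦋n⦌)⟦t⟧ ⟶ S),
    (((X.cohSS S).page 1).d ((n : ℤ), t) (((n + 1 : ℕ) : ℤ), t)).hom
        ((X.cohE₁ S n t).hom.hom x) =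
      (X.cohE₁ S (n + 1) t).hom.hom ((objD C n)⟦t⟧' ≫ x)
  converges : (X.cohCouple S).ConvergesConditionallyToLimit (fun n ↦ (X.tot⟦n⟧ ⟶ S))
    (fun σ n ↦ Preadditive.leftComp S ((X.toTot (σ - 1))⟦n⟧'))

/-- `S` is compact with respect to countable coproducts: every map from `S` to a countable
coproduct is a finite sum of maps to the summands. -/
def _root_.IsCompactForCoproducts (S : 𝒯) : Prop :=
  ∀ (P : ℕ → 𝒯) (g : S ⟶ ∐ P), ∃ (F : Finset ℕ) (g' : ∀ n, S ⟶ P n),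
    g = ∑ n ∈ F, g' n ≫ Sigma.ι P n

/-- The assertion that `homSS` is a spectral sequence `E^1_{s,t} = [S, Σ^t C_s]` (zero for
`s < 0`) with `d^1` induced by the alternating sum of the face maps, and that it converges
conditionally to the colimit of the groups `[S, Σ^{t-s} T_m]`, which is `[S, Σ^{t-s} Tot C]`
if `S` is compact. -/
structure IsHomSkeletalSS : Prop where
  isZero : ∀ s t : ℤ, s < 0 → IsZero (((X.homSS S).page 1).X (s, t))
  d_one : ∀ (n : ℕ) (t : ℤ) (x : S ⟶ (C _⦋n + 1⦌)⟦t⟧),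
    (((X.homSS S).page 1).d (((n + 1 : ℕ) : ℤ), t) ((n : ℤ), t)).hom
        ((X.homE₁ S (n + 1) t).hom.hom x) =
      (X.homE₁ S n t).hom.hom (x ≫ (objD C n)⟦t⟧')
  converges : (X.homCouple S).ConvergesConditionallyToColimit
  abutment : IsCompactForCoproducts S →
    (X.homCouple S).IsColimit (fun n ↦ (S ⟶ X.tot⟦n⟧))
      (fun σ n ↦ Preadditive.rightComp S ((X.toTot (-σ))⟦n⟧'))

/-- Maps induced by `f` on the pages `E_r`, `1 ≤ r < k`, of the cohomological spectral
sequences: they commute with the differentials `d_r` (being maps of complexes), the first is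
given by the maps `[Σ^t f_n, S]`, and each one is the map induced by the preceding one on
homology.  As `[-, S]` is contravariant, they go from the pages for `D` to those for `C`. -/
structure CohPageMaps (k : ℕ) where
  hom : ∀ (r : ℤ) (hr : 1 ≤ r), r < k → ((Y.cohSS S).page r hr ⟶ (X.cohSS S).page r hr)
  hom_one : ∀ (hk : (1 : ℤ) < k) (n : ℕ) (t : ℤ) (x : (D _⦋n⦌)⟦t⟧ ⟶ S),
    ((hom 1 le_rfl hk).f ((n : ℤ), t)).hom ((Y.cohE₁ S n t).hom.hom x) =
      (X.cohE₁ S n t).hom.hom ((f.app (Opposite.op ⦋n⦌))⟦t⟧' ≫ x)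
  comm : ∀ (r : ℤ) (hr : 1 ≤ r) (hk : r + 1 < k) (p : ℤ × ℤ),
    HomologicalComplex.homologyMap (hom r hr (by omega)) p ≫ ((X.cohSS S).iso r (r + 1) p).hom =
      ((Y.cohSS S).iso r (r + 1) p).hom ≫ (hom (r + 1) (by omega) hk).f p

/-- Maps induced by `f` on the pages `E^r`, `1 ≤ r < k`, of the homological spectral
sequences: they commute with the differentials `d^r` (being maps of complexes), the first is
given by the maps `[S, Σ^t f_n]`, and each one is the map induced by the preceding one on
homology. -/
structure HomPageMaps (k : ℕ) where
  hom : ∀ (r : ℤ) (hr : 1 ≤ r), r < k → ((X.homSS S).page r hr ⟶ (Y.homSS S).page r hr)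
  hom_one : ∀ (hk : (1 : ℤ) < k) (n : ℕ) (t : ℤ) (x : S ⟶ (C _⦋n⦌)⟦t⟧),
    ((hom 1 le_rfl hk).f ((n : ℤ), t)).hom ((X.homE₁ S n t).hom.hom x) =
      (Y.homE₁ S n t).hom.hom (x ≫ (f.app (Opposite.op ⦋n⦌))⟦t⟧')
  comm : ∀ (r : ℤ) (hr : 1 ≤ r) (hk : r + 1 < k) (p : ℤ × ℤ),
    HomologicalComplex.homologyMap (hom r hr (by omega)) p ≫ ((Y.homSS S).iso r (r + 1) p).hom =
      ((X.homSS S).iso r (r + 1) p).hom ≫ (hom (r + 1) (by omega) hk).f p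

end SpectralSequences

end Totalization

end Triangulated

/-!
A differential `d_r x = y` of an exact couple has a description on representatives: for
`H = [S, -]`, the image of `x` under one attaching map lifts `r - 1` stages down the tower, and the
lift restricts to `y`; for `H = [-, S]`, dually.  A map of `E_1`-pages that preserves these
relations for `1 ≤ r < k` induces maps of the pages `E_r` for these `r`.

For `r = 1` the relation is preserved because `f` is a chain map.  For `r = N ≥ 2`, that `0` lies in
`T(N, i; f)` means that there is a filtration-preserving map `φ` from `T^C_{[i,i+N-1]}` to
`T^D_{[i,i+N-1]}` which commutes exactly with the next attaching maps.  The composite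
`T^C_s ⟶ T^C_{[i,s]} ⟶ T^D_{[i,s]}` carries the relation for `C` to the subquotients of `D`.  The
square formed by `T^D_i ⟶ T^D_m` and `T^D_{[i,i]} ⟶ T^D_{[i,m]}` is weakly cartesian and weakly
cocartesian, as the fibre `T^D_{i-1}` is the same on both sides, so that the relation lifts from
the subquotients to the skeleta.

Convergence comes from the triangle of `1 - shift` on the coproduct of the skeleta `T_n`.  For
`H = [-, S]` it is the Milnor sequence.  For compact `S` and `H = [S, -]`, the reason is that the
composite of `1 - shift` with the map from the coproduct to `T_k` given by the transition maps is
the projection to `T_k`.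
-/

lemma abHomologyIso_inv_mk (K : ShortComplex AddCommGrpCat.{v}) (z : K.g.hom.ker) :
    K.abHomologyIso.inv.hom (QuotientAddGroup.mk' K.abToCycles.range z) =
      K.homologyπ.hom (K.abCyclesIso.inv.hom z) :=
  ConcreteCategory.congr_hom K.abLeftHomologyData.π_comp_homologyIso_inv z

lemma homologyMap_abHomologyIso_inv_mk {K L : ShortComplex AddCommGrpCat.{v}} (φ : K ⟶ L)
    (z : K.g.hom.ker) (w : L.g.hom.ker) (h : φ.τ₂.hom z.1 = w.1) :
    (ShortComplex.homologyMap φ).hom (K.abHomologyIso.inv.hom (QuotientAddGroup.mk' _ z)) =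
      L.abHomologyIso.inv.hom (QuotientAddGroup.mk' _ w) := by
  rw [abHomologyIso_inv_mk, abHomologyIso_inv_mk]
  have naturality := ConcreteCategory.congr_hom (ShortComplex.homologyπ_naturality φ)
    (K.abCyclesIso.inv.hom z)
  refine naturality.trans (congrArg L.homologyπ.hom ?_)
  apply (AddCommGrpCat.mono_iff_injective L.iCycles).1 inferInstance
  calc L.iCycles.hom ((ShortComplex.cyclesMap φ).hom (K.abCyclesIso.inv.hom z))
      = φ.τ₂.hom (K.iCycles.hom (K.abCyclesIso.inv.hom z)) :=
        ConcreteCategory.congr_hom (ShortComplex.cyclesMap_i φ) _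
    _ = φ.τ₂.hom z.1 := congrArg φ.τ₂.hom (K.abCyclesIso_inv_apply_iCycles z)
    _ = w.1 := h
    _ = L.iCycles.hom (L.abCyclesIso.inv.hom w) := (L.abCyclesIso_inv_apply_iCycles w).symm

lemma exists_injective_quotient_of_exact {A A' G G' : Type*} [AddCommGroup A] [AddCommGroup A']
    [AddCommGroup G] [AddCommGroup G'] {u : A' →+ A} {v : A →+ G} {w : G →+ G'}
    (huv : Function.Exact u v) (hvw : Function.Exact v w) :
    ∃ l : A ⧸ u.range →+ G, Function.Injective l ∧ ∀ x : G, x ∈ l.range ↔ w x = 0 := by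
  rw [← AddMonoidHom.exact_iff.1 huv]
  refine ⟨QuotientAddGroup.kerLift v, QuotientAddGroup.kerLift_injective v, fun x ↦ ?_⟩
  rw [hvw x, AddMonoidHom.mem_range, (QuotientAddGroup.mk'_surjective v.ker).exists]
  rfl

namespace ExactCouple

variable {g : CoupleGrading} {X Y : ExactCouple.{v} g}

/-- The maps `φ` between the first pages of two exact couples preserve the relation
`d_r x = y`.  This is stated for the relation on representatives rather than for the page `E_r`, so
that it makes sense before `φ` is known to induce a map on that page. -/
def PreservesDiff (φ : ∀ p, X.E p →+ Y.E p) (r : ℤ) (hr : 1 ≤ r) : Prop :=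
  ∀ ⦃p q : ℤ × ℤ⦄ (h : p + g.shift r = q) (x : X.E p) (y : X.E q),
    X.DiffRel r hr h x y → Y.DiffRel r hr h (φ p x) (φ q y)

variable {φ : ∀ p, X.E p →+ Y.E p} {r : ℤ} {hr : 1 ≤ r}

namespace PreservesDiff

lemma map_mem_cycles (H : PreservesDiff φ r hr) {p : ℤ × ℤ} {x : X.E p}
    (hx : x ∈ X.cycles r hr p) : φ p x ∈ Y.cycles r hr p := by
  obtain ⟨y, hxy⟩ := (X.exists_diffRel_iff r hr rfl x).2 hx
  exact (Y.exists_diffRel_iff r hr rfl _).1 ⟨_, H rfl x y hxy⟩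

lemma map_mem_boundaries (H : PreservesDiff φ r hr) {p : ℤ × ℤ} {y : X.E p}
    (hy : y ∈ X.boundaries r hr p) : φ p y ∈ Y.boundaries r hr p := by
  have h : (p - g.shift r) + g.shift r = p := sub_add_cancel _ _
  rw [← Y.diffRel_zero_iff r hr h, ← map_zero (φ _)]
  exact H h 0 y ((X.diffRel_zero_iff r hr h y).2 hy)

lemma map_mem_cycles_succ (H : PreservesDiff φ r hr) {p : ℤ × ℤ} {x : X.E p}
    (hx : x ∈ X.cycles (r + 1) (by omega) p) : φ p x ∈ Y.cycles (r + 1) (by omega) p := by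
  obtain ⟨y, hxy⟩ := (X.exists_diffRel_iff r hr rfl x).2 (X.cycles_le r hr hx)
  have hy := (X.diffRel_boundary_iff r hr rfl hxy).2 hx
  exact (Y.diffRel_boundary_iff r hr rfl (H rfl x y hxy)).1 (H.map_mem_boundaries hy)

lemma map_mem_boundaries_succ (H : PreservesDiff φ r hr) {p : ℤ × ℤ} {y : X.E p}
    (hy : y ∈ X.boundaries (r + 1) (by omega) p) :
    φ p y ∈ Y.boundaries (r + 1) (by omega) p := by
  have h : (p - g.shift r) + g.shift r = p := sub_add_cancel _ _
  obtain ⟨x, hxy⟩ := (X.exists_diffRel_iff_mem_boundaries r hr h y).2 hy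
  exact (Y.exists_diffRel_iff_mem_boundaries r hr h _).1 ⟨_, H h x y hxy⟩

-- If the source vanishes, only the `r + 1`-boundaries matter; if the target vanishes, only the
-- `r + 1`-cycles.  Both are determined by `d_r`.
lemma succ (H : PreservesDiff φ r hr)
    (H' : ∀ ⦃p q : ℤ × ℤ⦄ (h : p + g.shift (r + 1) = q) (x : X.E p) (y : X.E q),
      Nontrivial (X.E p) → Nontrivial (Y.E q) → X.DiffRel (r + 1) (by omega) h x y →
        Y.DiffRel (r + 1) (by omega) h (φ p x) (φ q y)) :
    PreservesDiff φ (r + 1) (by omega) := by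
  intro p q h x y hxy
  rcases subsingleton_or_nontrivial (X.E p) with _ | hp
  · obtain rfl := Subsingleton.elim x 0
    rw [map_zero, diffRel_zero_iff]
    exact H.map_mem_boundaries_succ ((X.diffRel_zero_iff _ _ h y).1 hxy)
  rcases subsingleton_or_nontrivial (Y.E q) with _ | hq
  · have hx := H.map_mem_cycles_succ ((X.exists_diffRel_iff _ _ h x).1 ⟨y, hxy⟩)
    obtain ⟨y', hxy'⟩ := (Y.exists_diffRel_iff _ _ h _).2 hx
    rwa [Subsingleton.elim (φ q y) y']
  · exact H' h x y hp hq hxy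

/-- The map induced on `r`-cycles by maps that preserve `d_r`. -/
def cyclesMap (H : PreservesDiff φ r hr) (p : ℤ × ℤ) : X.cycles r hr p →+ Y.cycles r hr p :=
  ((φ p).comp (X.cycles r hr p).subtype).codRestrict _ (fun x ↦ H.map_mem_cycles x.2)

/-- The map induced on the entry of `E_r` in position `p` by maps that preserve `d_r`. -/
def pageMapAt (H : PreservesDiff φ r hr) (p : ℤ × ℤ) : X.Page r hr p →+ Y.Page r hr p :=
  QuotientAddGroup.map _ _ (H.cyclesMap p) fun _ hx ↦ H.map_mem_boundaries hx

lemma pageMapAt_toPage (H : PreservesDiff φ r hr) (p : ℤ × ℤ) (x : X.cycles r hr p) :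
    H.pageMapAt p (X.toPage r hr p x) = Y.toPage r hr p (H.cyclesMap p x) := rfl

/-- The map of complexes induced on the page `E_r` by maps that preserve `d_r`. -/
noncomputable def pageMap (H : PreservesDiff φ r hr) : X.page r hr ⟶ Y.page r hr where
  f p := AddCommGrpCat.ofHom (H.pageMapAt p)
  comm' p q h := by
    have h : p + g.shift r = q := h
    refine AddCommGrpCat.hom_ext (AddMonoidHom.ext fun x ↦ ?_)
    change ((Y.page r hr).d p q).hom (H.pageMapAt p x) =
      H.pageMapAt q (((X.page r hr).d p q).hom x)
    obtain ⟨x, rfl⟩ := X.toPage_surjective r hr p x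
    obtain ⟨y, hxy⟩ := X.exists_rep r hr h x
    rw [Y.page_d_apply r hr h, X.page_d_apply r hr h, X.diff_toPage r hr h x y hxy,
      H.pageMapAt_toPage, H.pageMapAt_toPage]
    exact Y.diff_toPage r hr h _ _ (H h _ _ hxy)

lemma homologyMap_pageMap_iso (H : PreservesDiff φ r hr) {r' : ℤ} {hr' : 1 ≤ r'}
    (H' : PreservesDiff φ r' hr') (hrr' : r + 1 = r') (p : ℤ × ℤ) :
    HomologicalComplex.homologyMap H.pageMap p ≫ (Y.spectralSequence.iso r r' p hrr' hr).hom =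
      (X.spectralSequence.iso r r' p hrr' hr).hom ≫ H'.pageMap.f p := by
  refine (CommSq.horiz_inv (f := (X.spectralSequence.iso r r' p hrr' hr).symm)
    (i := (Y.spectralSequence.iso r r' p hrr' hr).symm) ⟨?_⟩).w.symm
  refine AddCommGrpCat.hom_ext (AddMonoidHom.ext fun x ↦ ?_)
  obtain ⟨x, rfl⟩ := X.toPage_surjective r' hr' p x
  exact homologyMap_abHomologyIso_inv_mk
    ((HomologicalComplex.shortComplexFunctor _ _ p).map H.pageMap) _ _ rfl

lemma pageMap_pageOneIso (H : PreservesDiff φ 1 le_rfl) (p : ℤ × ℤ) (x : X.E p) :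
    (H.pageMap.f p).hom ((X.pageOneIso p).hom.hom x) = (Y.pageOneIso p).hom.hom (φ p x) := rfl

end PreservesDiff

lemma page_one_d_pageOneIso {p q : ℤ × ℤ} (h : p + g.shift 1 = q) {x : X.E p} {y : X.E q}
    (hxy : X.DiffRel 1 le_rfl h x y) :
    ((X.spectralSequence.page 1).d p q).hom ((X.pageOneIso p).hom.hom x) =
      (X.pageOneIso q).hom.hom y :=
  (X.page_d_apply 1 le_rfl h _).trans (X.diff_toPage 1 le_rfl h _ _ hxy)

lemma isZero_page_one (p : ℤ × ℤ) [Subsingleton (X.E p)] :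
    IsZero ((X.spectralSequence.page 1).X p) :=
  (AddCommGrpCat.isZero_of_subsingleton (AddCommGrpCat.of (X.E p))).of_iso (X.pageOneIso p).symm

end ExactCouple

section AltComplex

variable {𝒯 : Type u} [Category.{v} 𝒯] [Preadditive 𝒯] [HasZeroObject 𝒯]

lemma altMap_comm {C D : SimplicialObject 𝒯} (f : C ⟶ D) (s' s : ℤ) :
    altMap f s' ≫ (altComplex D).d s' s = (altComplex C).d s' s ≫ altMap f s := by
  match s', s with
  | Int.ofNat n, Int.ofNat m =>
    exact (AlgebraicTopology.AlternatingFaceMapComplex.map f).comm n m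
  | Int.ofNat _, Int.negSucc _ => exact comp_zero.trans zero_comp.symm
  | Int.negSucc _, _ => exact comp_zero.trans zero_comp.symm

lemma altComplex_d_succ (C : SimplicialObject 𝒯) (n : ℕ) :
    (altComplex C).d ((n + 1 : ℕ) : ℤ) (n : ℤ) =
      AlgebraicTopology.AlternatingFaceMapComplex.objD C n :=
  AlgebraicTopology.AlternatingFaceMapComplex.obj_d_eq C n

lemma isZero_altComplex_X (C : SimplicialObject 𝒯) {s : ℤ} (hs : s < 0) :
    IsZero ((altComplex C).X s) := by
  match s, hs with
  | Int.negSucc _, _ => exact isZero_zero 𝒯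

end AltComplex

section Compact

variable {𝒯 : Type u} [Category.{v} 𝒯] [HasCoproductsOfShape ℕ 𝒯] [Preadditive 𝒯]
  [HasShift 𝒯 ℤ] {S : 𝒯} {P : ℕ → 𝒯} {n : ℤ}

lemma IsCompactForCoproducts.exists_eq_sum_shift (hS : IsCompactForCoproducts S)
    (y : S ⟶ (∐ P)⟦n⟧) :
    ∃ (F : Finset ℕ) (g : ∀ k, S ⟶ (P k)⟦n⟧), y = ∑ k ∈ F, g k ≫ (Sigma.ι P k)⟦n⟧' := by
  obtain ⟨F, g, hg⟩ := hS (fun m ↦ (P m)⟦n⟧) (y ≫ inv (sigmaComparison (shiftFunctor 𝒯 n) P))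
  refine ⟨F, g, ?_⟩
  rw [← cancel_mono (inv (sigmaComparison (shiftFunctor 𝒯 n) P)), hg, Preadditive.sum_comp]
  exact Finset.sum_congr rfl fun k _ ↦ by rw [assoc, map_ι_comp_inv_sigmaComparison]

variable [∀ n : ℤ, (shiftFunctor 𝒯 n).Additive]

lemma IsCompactForCoproducts.exists_eq_sum_components (hS : IsCompactForCoproducts S)
    (y : S ⟶ (∐ P)⟦n⟧) :
    ∃ F : Finset ℕ, (∀ k ∉ F, y ≫ (Sigma.π P k)⟦n⟧' = 0) ∧
      y = ∑ k ∈ F, (y ≫ (Sigma.π P k)⟦n⟧') ≫ (Sigma.ι P k)⟦n⟧' := by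
  obtain ⟨F, g, hy⟩ := hS.exists_eq_sum_shift y
  have component (k : ℕ) : y ≫ (Sigma.π P k)⟦n⟧' = if k ∈ F then g k else 0 := by
    have off_diagonal (j : ℕ) (hjk : j ≠ k) :
        (g j ≫ (Sigma.ι P j)⟦n⟧') ≫ (Sigma.π P k)⟦n⟧' = 0 := by
      rw [assoc, ← Functor.map_comp, Sigma.ι_π_of_ne _ hjk, Functor.map_zero, comp_zero]
    rw [hy, Preadditive.sum_comp]
    split_ifs with hk
    · rw [Finset.sum_eq_single_of_mem k hk fun j _ hjk ↦ off_diagonal j hjk, assoc,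
        ← Functor.map_comp, Sigma.ι_π_eq_id, CategoryTheory.Functor.map_id, comp_id]
    · exact Finset.sum_eq_zero fun j hj ↦ off_diagonal j (ne_of_mem_of_not_mem hj hk)
  refine ⟨F, fun k hk ↦ by rw [component, if_neg hk], hy.trans (Finset.sum_congr rfl fun k hk ↦ ?_)⟩
  rw [component, if_pos hk]

end Compact

section Telescope

variable {𝒯 : Type u} [Category.{v} 𝒯] [HasCoproductsOfShape ℕ 𝒯] (T : ℤ ⥤ 𝒯)

/-- The map `T_s ⟶ ∐ T_n` into the coproduct that defines the homotopy colimit, by way of `T_0`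
if `s < 0`. -/
noncomputable def toSigma (s : ℤ) : T.obj s ⟶ ∐ fun n : ℕ ↦ T.obj n :=
  T.map (homOfLE (Int.self_le_toNat s)) ≫ Sigma.ι (fun n : ℕ ↦ T.obj n) s.toNat

lemma toSigma_natCast (n : ℕ) : toSigma T n = Sigma.ι (fun n : ℕ ↦ T.obj n) n :=
  (congrArg (· ≫ _) (T.map_id (n : ℤ))).trans (id_comp _)

variable [Preadditive 𝒯]

lemma ι_oneSubShift (n : ℕ) :
    Sigma.ι (fun n : ℕ ↦ T.obj n) n ≫ oneSubShift T = Sigma.ι (fun n : ℕ ↦ T.obj n) n -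
      T.map (homOfLE (show (n : ℤ) ≤ ((n + 1 : ℕ) : ℤ) by omega)) ≫
        Sigma.ι (fun n : ℕ ↦ T.obj n) (n + 1) :=
  Sigma.ι_desc _ _

/-- The map `∐ T_n ⟶ T_s` given by the transition maps of the tower on the `T_n` with `n ≤ s`, and
zero on the others.  For `s ≥ 0`, the composite with `1 - shift` is the projection to `T_s`. -/
noncomputable def toStage (s : ℤ) : (∐ fun n : ℕ ↦ T.obj n) ⟶ T.obj s :=
  Sigma.desc fun n : ℕ ↦ if h : (n : ℤ) ≤ s then T.map (homOfLE h) else 0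

variable {T}

lemma ι_toStage {n : ℕ} {s : ℤ} (h : (n : ℤ) ≤ s) :
    Sigma.ι (fun n : ℕ ↦ T.obj n) n ≫ toStage T s = T.map (homOfLE h) :=
  (Sigma.ι_desc _ _).trans (dif_pos h)

lemma ι_toStage_of_lt {n : ℕ} {s : ℤ} (h : s < n) :
    Sigma.ι (fun n : ℕ ↦ T.obj n) n ≫ toStage T s = 0 :=
  (Sigma.ι_desc _ _).trans (dif_neg h.not_ge)

lemma toSigma_toStage {s : ℤ} {k : ℕ} (h : s ≤ k) :
    toSigma T s ≫ toStage T k = T.map (homOfLE h) := by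
  rw [toSigma, assoc, ι_toStage (by omega), ← Functor.map_comp, homOfLE_comp]

lemma oneSubShift_toStage (k : ℕ) :
    oneSubShift T ≫ toStage T k = Sigma.π (fun n : ℕ ↦ T.obj n) k := by
  refine Sigma.hom_ext _ _ fun n ↦ ?_
  rw [reassoc_of% ι_oneSubShift T n, Preadditive.sub_comp, assoc]
  obtain hnk | rfl | hkn := lt_trichotomy n k
  · rw [Sigma.ι_π_of_ne _ hnk.ne, ι_toStage (by omega), ι_toStage (by omega), ← Functor.map_comp,
      homOfLE_comp, sub_self]
  · rw [Sigma.ι_π_eq_id, ι_toStage le_rfl, ι_toStage_of_lt (by omega), comp_zero, sub_zero]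
    exact T.map_id _
  · rw [Sigma.ι_π_of_ne _ hkn.ne', ι_toStage_of_lt (by omega), ι_toStage_of_lt (by omega),
      comp_zero, sub_zero]

variable [HasShift 𝒯 ℤ] [∀ n : ℤ, (shiftFunctor 𝒯 n).Additive] {S : 𝒯} {n : ℤ}

lemma IsCompactForCoproducts.eq_zero_of_comp_oneSubShift (hS : IsCompactForCoproducts S)
    {y : S ⟶ (∐ fun n : ℕ ↦ T.obj n)⟦n⟧} (hy : y ≫ (oneSubShift T)⟦n⟧' = 0) : y = 0 := by
  obtain ⟨F, -, hsum⟩ := hS.exists_eq_sum_components y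
  refine hsum.trans (Finset.sum_eq_zero fun k _ ↦ ?_)
  rw [← oneSubShift_toStage, Functor.map_comp, reassoc_of% hy, zero_comp, zero_comp]

lemma IsCompactForCoproducts.exists_comp_map_eq_zero (hS : IsCompactForCoproducts S) {s : ℤ}
    {a : S ⟶ (T.obj s)⟦n⟧} {y : S ⟶ (∐ fun n : ℕ ↦ T.obj n)⟦n⟧}
    (hy : y ≫ (oneSubShift T)⟦n⟧' = a ≫ (toSigma T s)⟦n⟧') :
    ∃ (s' : ℤ) (h : s ≤ s'), a ≫ (T.map (homOfLE h))⟦n⟧' = 0 := by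
  obtain ⟨F, hF, -⟩ := hS.exists_eq_sum_components y
  obtain ⟨k, hk⟩ := (F ∪ Finset.range s.toNat).exists_notMem
  rw [Finset.mem_union, Finset.mem_range, not_or] at hk
  refine ⟨k, by omega, ?_⟩
  rw [← toSigma_toStage, Functor.map_comp, ← reassoc_of% hy, ← Functor.map_comp,
    oneSubShift_toStage, hF k hk.1]

end Telescope

section Triangulated

variable {𝒯 : Type u} [Category.{v} 𝒯] [Preadditive 𝒯] [HasZeroObject 𝒯]
  [HasShift 𝒯 ℤ] [∀ n : ℤ, (shiftFunctor 𝒯 n).Additive] [Pretriangulated 𝒯]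

section Exactness

variable {A B B' Q Q' S : 𝒯} {f : A ⟶ B} {g : B ⟶ Q} {h : Q ⟶ A⟦(1 : ℤ)⟧}

lemma yoneda_exact_shift₃ (hT : Triangle.mk f g h ∈ distTriang 𝒯) (n : ℤ)
    {b : Q⟦n⟧ ⟶ S} (hb : g⟦n⟧' ≫ b = 0) : ∃ c : (A⟦(1 : ℤ)⟧)⟦n⟧ ⟶ S, h⟦n⟧' ≫ c = b :=
  yoneda_exact_shift (rot_of_distTriang _ hT) n hb

lemma coyoneda_exact_shift₃ (hT : Triangle.mk f g h ∈ distTriang 𝒯) (n : ℤ)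
    {b : S ⟶ Q⟦n⟧} (hb : b ≫ h⟦n⟧' = 0) : ∃ c : S ⟶ B⟦n⟧, c ≫ g⟦n⟧' = b :=
  coyoneda_exact_shift (rot_of_distTriang _ hT) n hb

lemma yoneda_exact_shift₁ (hT : Triangle.mk f g h ∈ distTriang 𝒯) (n : ℤ)
    {b : (A⟦(1 : ℤ)⟧)⟦n⟧ ⟶ S} (hb : h⟦n⟧' ≫ b = 0) :
    ∃ c : (B⟦(1 : ℤ)⟧)⟦n⟧ ⟶ S, (f⟦(1 : ℤ)⟧')⟦n⟧' ≫ c = b := by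
  obtain ⟨c, hc⟩ : ∃ c : (B⟦(1 : ℤ)⟧)⟦n⟧ ⟶ S, (-(f⟦(1 : ℤ)⟧'))⟦n⟧' ≫ c = b :=
    yoneda_exact_shift (rot_of_distTriang _ (rot_of_distTriang _ hT)) n hb
  exact ⟨-c, by rw [← hc, Functor.map_neg, Preadditive.neg_comp, Preadditive.comp_neg]⟩

lemma shift_comp_zero₁₂ (hT : Triangle.mk f g h ∈ distTriang 𝒯) (n : ℤ) :
    f⟦n⟧' ≫ g⟦n⟧' = 0 := by
  have hfg : f ≫ g = 0 := comp_distTriang_mor_zero₁₂ _ hT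
  rw [← Functor.map_comp, hfg, Functor.map_zero]

lemma shift_comp_zero₂₃ (hT : Triangle.mk f g h ∈ distTriang 𝒯) (n : ℤ) :
    g⟦n⟧' ≫ h⟦n⟧' = 0 := by
  have hgh : g ≫ h = 0 := comp_distTriang_mor_zero₂₃ _ hT
  rw [← Functor.map_comp, hgh, Functor.map_zero]

variable {u : B ⟶ B'} {v : Q ⟶ Q'} {g' : B' ⟶ Q'} {h' : Q' ⟶ A⟦(1 : ℤ)⟧}

-- The square from `u` to `v` is weakly cartesian and weakly cocartesian, since the cones of its
-- horizontal maps are identified.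
lemma exists_lift_of_distTriang_comp (hT : Triangle.mk f g h ∈ distTriang 𝒯)
    (hT' : Triangle.mk (f ≫ u) g' h' ∈ distTriang 𝒯) (huv : u ≫ g' = g ≫ v) (hv : v ≫ h' = h)
    (n : ℤ) {β : S ⟶ Q⟦n⟧} {c : S ⟶ B'⟦n⟧} (hβc : β ≫ v⟦n⟧' = c ≫ g'⟦n⟧') :
    ∃ b : S ⟶ B⟦n⟧, b ≫ u⟦n⟧' = c ∧ b ≫ g⟦n⟧' = β := by
  obtain ⟨b, hb⟩ : ∃ b : S ⟶ B⟦n⟧, b ≫ g⟦n⟧' = β := by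
    refine coyoneda_exact_shift₃ hT n ?_
    rw [← hv, Functor.map_comp, reassoc_of% hβc, shift_comp_zero₂₃ hT', comp_zero]
  obtain ⟨e, he⟩ : ∃ e : S ⟶ A⟦n⟧, e ≫ (f ≫ u)⟦n⟧' = b ≫ u⟦n⟧' - c := by
    refine coyoneda_exact_shift hT' n ?_
    rw [Preadditive.sub_comp, assoc, ← Functor.map_comp, huv, Functor.map_comp, reassoc_of% hb,
      hβc, sub_self]
  refine ⟨b - e ≫ f⟦n⟧', ?_, ?_⟩
  · rw [Preadditive.sub_comp, assoc, ← Functor.map_comp, he, sub_sub_cancel]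
  · rw [Preadditive.sub_comp, assoc, shift_comp_zero₁₂ hT, comp_zero, sub_zero, hb]

lemma exists_desc_of_distTriang_comp (hT : Triangle.mk f g h ∈ distTriang 𝒯)
    (hT' : Triangle.mk (f ≫ u) g' h' ∈ distTriang 𝒯) (huv : u ≫ g' = g ≫ v) (hv : v ≫ h' = h)
    (n : ℤ) {a : B'⟦n⟧ ⟶ S} {ξ : Q⟦n⟧ ⟶ S} (haξ : u⟦n⟧' ≫ a = g⟦n⟧' ≫ ξ) :
    ∃ γ : Q'⟦n⟧ ⟶ S, g'⟦n⟧' ≫ γ = a ∧ v⟦n⟧' ≫ γ = ξ := by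
  obtain ⟨α, hα⟩ : ∃ α : Q'⟦n⟧ ⟶ S, g'⟦n⟧' ≫ α = a := by
    refine yoneda_exact_shift hT' n ?_
    rw [Functor.map_comp, assoc, haξ, ← assoc, shift_comp_zero₁₂ hT, zero_comp]
  obtain ⟨e, he⟩ : ∃ e : (A⟦(1 : ℤ)⟧)⟦n⟧ ⟶ S, h⟦n⟧' ≫ e = v⟦n⟧' ≫ α - ξ := by
    refine yoneda_exact_shift₃ hT n ?_
    rw [Preadditive.comp_sub, ← Functor.map_comp_assoc, ← huv, Functor.map_comp, assoc, hα, haξ,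
      sub_self]
  refine ⟨α - h'⟦n⟧' ≫ e, ?_, ?_⟩
  · rw [Preadditive.comp_sub, ← assoc, shift_comp_zero₂₃ hT', zero_comp, sub_zero, hα]
  · rw [Preadditive.comp_sub, ← Functor.map_comp_assoc, hv, he, sub_sub_cancel]

/-- The map `Σ^n Q ⟶ Σ^{n+1} A` given by the connecting map `h` of a triangle. -/
noncomputable def connShift (h : Q ⟶ A⟦(1 : ℤ)⟧) (n : ℤ) : Q⟦n⟧ ⟶ A⟦n + 1⟧ :=
  h⟦n⟧' ≫ (shiftFunctorAdd' 𝒯 1 n (n + 1) (add_comm _ _)).inv.app A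

lemma connShift_comp_zero (hT : Triangle.mk f g h ∈ distTriang 𝒯) (n : ℤ) :
    connShift h n ≫ f⟦n + 1⟧' = 0 := by
  have hhf : h ≫ f⟦(1 : ℤ)⟧' = 0 := comp_distTriang_mor_zero₃₁ _ hT
  have naturality := (shiftFunctorAdd' 𝒯 1 n (n + 1) (add_comm _ _)).inv.naturality f
  rw [connShift, assoc, ← naturality]
  change h⟦n⟧' ≫ (f⟦(1 : ℤ)⟧')⟦n⟧' ≫ _ = 0
  rw [← Functor.map_comp_assoc, hhf, Functor.map_zero, zero_comp]

lemma coyoneda_exact_connShift (hT : Triangle.mk f g h ∈ distTriang 𝒯) (n : ℤ) {b : S ⟶ Q⟦n⟧}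
    (hb : b ≫ connShift h n = 0) : ∃ c : S ⟶ B⟦n⟧, c ≫ g⟦n⟧' = b := by
  rw [connShift, ← assoc, Preadditive.IsIso.comp_right_eq_zero] at hb
  exact coyoneda_exact_shift₃ hT n hb

variable (S)

lemma exact_leftComp_shift₂₁ (hT : Triangle.mk f g h ∈ distTriang 𝒯) (n : ℤ) :
    Function.Exact (Preadditive.leftComp S (g⟦n⟧')) (Preadditive.leftComp S (f⟦n⟧')) := by
  refine fun b ↦ ⟨fun hb ↦ yoneda_exact_shift hT n hb, ?_⟩
  rintro ⟨c, rfl⟩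
  change f⟦n⟧' ≫ g⟦n⟧' ≫ c = 0
  rw [← assoc, shift_comp_zero₁₂ hT, zero_comp]

lemma exact_leftComp_connShift_shift₂ (hT : Triangle.mk f g h ∈ distTriang 𝒯) (n : ℤ) :
    Function.Exact (Preadditive.leftComp S (connShift h n)) (Preadditive.leftComp S (g⟦n⟧')) := by
  refine fun b ↦ ⟨fun hb ↦ ?_, ?_⟩
  · obtain ⟨c, rfl⟩ := yoneda_exact_shift₃ hT n hb
    refine ⟨(shiftFunctorAdd' 𝒯 1 n (n + 1) (add_comm _ _)).hom.app _ ≫ c, ?_⟩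
    change connShift h n ≫ _ = _
    rw [connShift, assoc, Iso.inv_hom_id_app_assoc]
  · rintro ⟨c, rfl⟩
    change g⟦n⟧' ≫ connShift h n ≫ c = 0
    rw [connShift, assoc, ← assoc, shift_comp_zero₂₃ hT, zero_comp]

lemma exact_leftComp_shift₁_connShift (hT : Triangle.mk f g h ∈ distTriang 𝒯) (n : ℤ) :
    Function.Exact (Preadditive.leftComp S (f⟦n + 1⟧'))
      (Preadditive.leftComp S (connShift h n)) := by
  refine fun b ↦ ⟨fun hb ↦ ?_, ?_⟩
  · change connShift h n ≫ b = 0 at hb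
    rw [connShift, assoc] at hb
    obtain ⟨c, hc⟩ := yoneda_exact_shift₁ hT n hb
    refine ⟨(shiftFunctorAdd' 𝒯 1 n (n + 1) (add_comm _ _)).hom.app _ ≫ c, ?_⟩
    have naturality := (shiftFunctorAdd' 𝒯 1 n (n + 1) (add_comm _ _)).hom.naturality f
    change f⟦n + 1⟧' ≫ _ = b
    rw [reassoc_of% naturality]
    exact (congrArg _ hc).trans (Iso.hom_inv_id_app_assoc _ _ _)
  · rintro ⟨c, rfl⟩
    change connShift h n ≫ f⟦n + 1⟧' ≫ c = 0
    rw [← assoc, connShift_comp_zero hT, zero_comp]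

end Exactness

variable [HasCoproductsOfShape ℕ 𝒯]

namespace Totalization

variable {C D : SimplicialObject 𝒯} {X : Totalization C} {Y : Totalization D}

section Skeleta

variable (X) in
lemma isZero_shift_skel {s : ℤ} (hs : s < 0) (n : ℤ) : IsZero ((X.skel.obj s)⟦n⟧) :=
  (shiftFunctor 𝒯 n).map_isZero (X.isZero_skel s hs)

lemma skelShift_refl (s n : ℤ) : X.skelShift (le_refl s) n = 𝟙 _ := by
  simp [skelShift]

lemma attachShift_projShift (s s' n t : ℤ) (h : s + 1 = s') (ht : s + n = t) :
    X.attachShift s s' n t h ht ≫ X.projShift s s n t rfl ht = ((altComplex C).d s' s)⟦t⟧' := by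
  rw [projShift_eq, attachShift, assoc, ← Functor.map_comp_assoc, X.attach_proj,
    ← cancel_mono ((shiftFunctorAdd' 𝒯 s n t ht).hom.app _), assoc, assoc, Iso.inv_hom_id_app]
  exact (congrArg _ (comp_id _)).trans
    ((shiftFunctorAdd' 𝒯 s n t ht).hom.naturality ((altComplex C).d s' s)).symm

end Skeleta

section DiffRel

variable {S : 𝒯}

lemma cohCouple_diffRel_iff {r s t s' t' m n : ℤ} (hr : 1 ≤ r)
    (h : ((s, t) : ℤ × ℤ) + (r, r - 1) = (s', t')) (hm : m + 1 = s') (hn : s + n = t)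
    (hn' : m + n = t') (hsm : s ≤ m) (x : ((altComplex C).X s)⟦t⟧ ⟶ S)
    (y : ((altComplex C).X s')⟦t'⟧ ⟶ S) :
    (X.cohCouple S).DiffRel r hr (p := (s, t)) (q := (s', t')) h x y ↔
      ∃ a : (X.skel.obj m)⟦n⟧ ⟶ S,
        X.skelShift hsm n ≫ a = X.projShift s s n t rfl hn ≫ x ∧
          X.attachShift m s' n t' hm hn' ≫ a = y := by
  obtain rfl : s' - 1 = m := by omega
  obtain rfl : t' - s' + 1 = n := by omega
  have key : ∀ (i : ℤ) (hi : i = s) (hi' : i ≤ s' - 1)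
      (a : (X.skel.obj (s' - 1))⟦t' - s' + 1⟧ ⟶ S),
      X.skelShift hi' _ ≫ a = X.projShift i s _ t hi hn ≫ x ↔
        X.skelShift hsm _ ≫ a = X.projShift s s _ t rfl hn ≫ x := by
    rintro i rfl hi' a
    rfl
  exact exists_congr fun a ↦ and_congr_left' (key (s + 1 - 1) (by omega) (by omega) a)

lemma homCouple_diffRel_iff {r s t s' t' m n : ℤ} (hr : 1 ≤ r)
    (h : ((s', t') : ℤ × ℤ) + (-r, 1 - r) = (s, t)) (hm : m + 1 = s') (hn : s + n = t)
    (hn' : m + n = t') (hsm : s ≤ m) (x : S ⟶ ((altComplex C).X s')⟦t'⟧)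
    (y : S ⟶ ((altComplex C).X s)⟦t⟧) :
    (X.homCouple S).DiffRel r hr (p := (s', t')) (q := (s, t)) h x y ↔
      ∃ a : S ⟶ (X.skel.obj s)⟦n⟧,
        a ≫ X.skelShift hsm n = x ≫ X.attachShift m s' n t' hm hn' ∧
          a ≫ X.projShift s s n t rfl hn = y := by
  obtain rfl : t - s = n := by omega
  have key : ∀ (i j : ℤ) (hi : i = s) (_ : j = m) (hij : i ≤ j) (hj : j + 1 = s')
      (ht' : j + (t - s) = t'),
      (∃ a : S ⟶ (X.skel.obj i)⟦t - s⟧,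
        a ≫ X.skelShift hij _ = x ≫ X.attachShift j s' _ t' hj ht' ∧
          a ≫ X.projShift i s _ t hi hn = y) ↔
        ∃ a : S ⟶ (X.skel.obj s)⟦t - s⟧,
          a ≫ X.skelShift hsm _ = x ≫ X.attachShift m s' _ t' hm hn' ∧
            a ≫ X.projShift s s _ t rfl hn = y := by
    rintro i j rfl rfl _ _ _
    rfl
  exact key (- -s) (-(-s' + 1)) (by omega) (by omega) (by simp at h; omega) (by omega)
    (by simp at h; omega)

lemma cohCouple_diffRel_one_iff {s t s' : ℤ} (h : ((s, t) : ℤ × ℤ) + (1, 1 - 1) = (s', t))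
    (x : ((altComplex C).X s)⟦t⟧ ⟶ S) (y : ((altComplex C).X s')⟦t⟧ ⟶ S) :
    (X.cohCouple S).DiffRel 1 le_rfl (p := (s, t)) (q := (s', t)) h x y ↔
      ((altComplex C).d s' s)⟦t⟧' ≫ x = y := by
  obtain rfl : s + 1 = s' := congrArg Prod.fst h
  rw [cohCouple_diffRel_iff le_rfl h rfl (add_sub_cancel s t) (add_sub_cancel s t) le_rfl]
  simp [skelShift_refl, reassoc_of% attachShift_projShift (X := X)]

lemma homCouple_diffRel_one_iff {s t s' : ℤ} (h : ((s', t) : ℤ × ℤ) + (-1, 1 - 1) = (s, t))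
    (x : S ⟶ ((altComplex C).X s')⟦t⟧) (y : S ⟶ ((altComplex C).X s)⟦t⟧) :
    (X.homCouple S).DiffRel 1 le_rfl (p := (s', t)) (q := (s, t)) h x y ↔
      x ≫ ((altComplex C).d s' s)⟦t⟧' = y := by
  obtain rfl : s + 1 = s' := by
    have := congrArg Prod.fst h
    dsimp only [Prod.fst_add] at this
    omega
  rw [homCouple_diffRel_iff le_rfl h rfl (add_sub_cancel s t) (add_sub_cancel s t) le_rfl]
  simp [skelShift_refl, attachShift_projShift]

end DiffRel

variable {f : C ⟶ D}

section Transfer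

variable {i m : ℤ} {U : X.Subquotient i} {V : Y.Subquotient i}

/-- The map `Σ^n V_i ⟶ Σ^t D_i` given by the projection `V_i ⟶ Σ^i D_i`, for `t = i + n`. -/
noncomputable def Subquotient.projShift (V : Y.Subquotient i) (n t : ℤ) (ht : i + n = t) :
    (V.obj.obj i)⟦n⟧ ⟶ ((altComplex D).X i)⟦t⟧ :=
  (V.proj i le_rfl)⟦n⟧' ≫ (shiftFunctorAdd' 𝒯 i n t ht).inv.app _

lemma Subquotient.quot_projShift (V : Y.Subquotient i) (n t : ℤ) (ht : i + n = t) :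
    (V.quot.app i)⟦n⟧' ≫ V.projShift n t ht = Y.projShift i i n t rfl ht := by
  rw [projShift, projShift_eq, ← Functor.map_comp_assoc, V.quot_proj]

namespace FilteredMap

lemma comm_map_of_le (φ : FilteredMap f U V m) {s s' : ℤ} (hs : i ≤ s) (hss' : s ≤ s')
    (hs' : s' ≤ m) :
    U.obj.map (homOfLE hss') ≫ φ.app s' (hs.trans hss') hs' =
      φ.app s hs (hss'.trans hs') ≫ V.obj.map (homOfLE hss') := by
  induction s', hss' using Int.leInduction with
  | base => simp only [homOfLE_refl, CategoryTheory.Functor.map_id, id_comp, comp_id]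
  | succ j hj ih =>
    have hU := U.obj.map_comp (homOfLE hj) (homOfLE (show j ≤ j + 1 by omega))
    have hV := V.obj.map_comp (homOfLE hj) (homOfLE (show j ≤ j + 1 by omega))
    rw [homOfLE_comp] at hU hV
    rw [hU, hV, assoc, φ.comm_map j (j + 1) rfl (hs.trans hj) hs',
      reassoc_of% (ih (by omega))]

/-- The composite `T_s ⟶ U_s ⟶ V_s` of the quotient map with a filtered map. -/
def fromSkel (φ : FilteredMap f U V m) (s : ℤ) (hs : i ≤ s) (hs' : s ≤ m) :
    X.skel.obj s ⟶ V.obj.obj s :=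
  U.quot.app s ≫ φ.app s hs hs'

/-- The filtered map `φ : U_m ⟶ V_m` commutes with the attaching maps of the cells of degree
`s' = m + 1`, the first ones outside its range. -/
def CommNextAttach (φ : FilteredMap f U V m) (hi : i ≤ m) (s' : ℤ) (h : m + 1 = s') : Prop :=
  U.attach m s' h ≫ φ.app m hi le_rfl = (altMap f s')⟦m⟧' ≫ V.attach m s' h

variable (φ : FilteredMap f U V m)

lemma skelShift_fromSkel (hi : i ≤ m) (n : ℤ) :
    X.skelShift hi n ≫ (φ.fromSkel m hi le_rfl)⟦n⟧' =
      (φ.fromSkel i le_rfl hi)⟦n⟧' ≫ (V.obj.map (homOfLE hi))⟦n⟧' := by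
  rw [skelShift, ← Functor.map_comp, ← Functor.map_comp, fromSkel, fromSkel, assoc,
    U.quot.naturality_assoc, φ.comm_map_of_le]

lemma fromSkel_projShift (hi : i ≤ m) (n t : ℤ) (ht : i + n = t) :
    (φ.fromSkel i le_rfl hi)⟦n⟧' ≫ V.projShift n t ht =
      X.projShift i i n t rfl ht ≫ (altMap f i)⟦t⟧' := by
  have hproj : φ.fromSkel i le_rfl hi ≫ V.proj i le_rfl = X.proj i ≫ (altMap f i)⟦i⟧' := by
    rw [fromSkel, assoc, ← φ.comm_proj, ← U.quot_proj i le_rfl, assoc]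
  have naturality := (shiftFunctorAdd' 𝒯 i n t ht).inv.naturality (altMap f i)
  rw [Subquotient.projShift, ← Functor.map_comp_assoc, hproj, projShift_eq, assoc, ← naturality,
    Functor.map_comp, assoc]
  rfl

lemma CommNextAttach.attachShift_fromSkel {φ : FilteredMap f U V m} {hi : i ≤ m} {s' : ℤ}
    {h : m + 1 = s'} (hφ : φ.CommNextAttach hi s' h) (n t : ℤ) (ht : m + n = t) :
    X.attachShift m s' n t h ht ≫ (φ.fromSkel m hi le_rfl)⟦n⟧' =
      (altMap f s')⟦t⟧' ≫ Y.attachShift m s' n t h ht ≫ (V.quot.app m)⟦n⟧' := by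
  have hattach : X.attach m s' h ≫ φ.fromSkel m hi le_rfl =
      (altMap f s')⟦m⟧' ≫ Y.attach m s' h ≫ V.quot.app m := (assoc _ _ _).symm.trans hφ
  have naturality := (shiftFunctorAdd' 𝒯 m n t ht).hom.naturality (altMap f s')
  rw [attachShift, attachShift, assoc, assoc, reassoc_of% naturality, ← Functor.map_comp, hattach,
    Functor.map_comp, Functor.map_comp]

namespace CommNextAttach

variable {φ} {hi : i ≤ m} {s' : ℤ} {h : m + 1 = s'} {S : 𝒯} {n t t' : ℤ}

lemma exists_lift (hφ : φ.CommNextAttach hi s' h) (ht : m + n = t) (ht' : i + n = t')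
    {x : S ⟶ ((altComplex C).X s')⟦t⟧} {a : S ⟶ (X.skel.obj i)⟦n⟧}
    (ha : a ≫ X.skelShift hi n = x ≫ X.attachShift m s' n t h ht) :
    ∃ b : S ⟶ (Y.skel.obj i)⟦n⟧,
      b ≫ Y.skelShift hi n = (x ≫ (altMap f s')⟦t⟧') ≫ Y.attachShift m s' n t h ht ∧
        b ≫ Y.projShift i i n t' rfl ht' =
          (a ≫ X.projShift i i n t' rfl ht') ≫ (altMap f i)⟦t'⟧' := by
  have htriangle := V.distinguished_quot m hi
  rw [← homOfLE_comp (show i - 1 ≤ i by omega) hi, Functor.map_comp] at htriangle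
  obtain ⟨b, hb, hbq⟩ := exists_lift_of_distTriang_comp (V.distinguished_quot i le_rfl) htriangle
    (V.quot.naturality (homOfLE hi)) (V.map_conn i m le_rfl hi) n
    (β := a ≫ (φ.fromSkel i le_rfl hi)⟦n⟧')
    (c := (x ≫ (altMap f s')⟦t⟧') ≫ Y.attachShift m s' n t h ht)
    (by rw [assoc, ← φ.skelShift_fromSkel, reassoc_of% ha, hφ.attachShift_fromSkel, assoc, assoc])
  refine ⟨b, hb, ?_⟩
  rw [← V.quot_projShift, reassoc_of% hbq, φ.fromSkel_projShift, assoc]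

lemma exists_desc (hφ : φ.CommNextAttach hi s' h) (ht : m + n = t) (ht' : i + n = t')
    {x : ((altComplex D).X i)⟦t'⟧ ⟶ S} {a : (Y.skel.obj m)⟦n⟧ ⟶ S}
    (ha : Y.skelShift hi n ≫ a = Y.projShift i i n t' rfl ht' ≫ x) :
    ∃ b : (X.skel.obj m)⟦n⟧ ⟶ S,
      X.skelShift hi n ≫ b = X.projShift i i n t' rfl ht' ≫ (altMap f i)⟦t'⟧' ≫ x ∧
        X.attachShift m s' n t h ht ≫ b =
          (altMap f s')⟦t⟧' ≫ Y.attachShift m s' n t h ht ≫ a := by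
  have htriangle := V.distinguished_quot m hi
  rw [← homOfLE_comp (show i - 1 ≤ i by omega) hi, Functor.map_comp] at htriangle
  obtain ⟨γ, hγ, hγi⟩ := exists_desc_of_distTriang_comp (V.distinguished_quot i le_rfl) htriangle
    (V.quot.naturality (homOfLE hi)) (V.map_conn i m le_rfl hi) n (a := a)
    (ξ := V.projShift n t' ht' ≫ x)
    (by rw [← assoc, V.quot_projShift, ← ha]; rfl)
  refine ⟨(φ.fromSkel m hi le_rfl)⟦n⟧' ≫ γ, ?_, ?_⟩
  · rw [reassoc_of% φ.skelShift_fromSkel hi n, hγi,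
      reassoc_of% φ.fromSkel_projShift hi n t' ht']
  · rw [reassoc_of% hφ.attachShift_fromSkel n t ht, hγ]

end CommNextAttach

end FilteredMap

lemma exists_commNextAttach_of_zero_mem_todaBracket {N : ℕ} (hN : 2 ≤ N)
    (H : ∀ i : ℕ, 0 ∈ X.todaBracket Y f N hN i) {i m s' : ℤ} (hi₀ : 0 ≤ i) (hi : i ≤ m)
    (h : m + 1 = s') (hs' : i + N = s') :
    ∃ (U : X.Subquotient i) (V : Y.Subquotient i) (φ : FilteredMap f U V m),
      φ.CommNextAttach hi s' h := by
  lift i to ℕ using hi₀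
  obtain rfl : ((i + N : ℕ) : ℤ) = s' := by push_cast; exact hs'
  obtain rfl : m = i + N - 1 := by omega
  obtain ⟨U, V, φ, θ, hθ, hdiff⟩ := H i
  have hθ₀ : θ = 0 := by
    rw [Functor.map_zero, comp_zero] at hθ
    obtain ⟨y, hy⟩ := Triangle.coyoneda_exact₃ _
      (V.distinguished (i - 1) i (by omega) le_rfl) θ
      ((assoc _ _ _).symm.trans ((congrArg (· ≫ _) hθ).trans zero_comp))
    obtain rfl : y = 0 := (V.isZero_obj _ (by omega)).eq_of_tgt _ _
    exact hy.trans zero_comp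
  rw [hθ₀, zero_comp] at hdiff
  exact ⟨U, V, φ, sub_eq_zero.1 hdiff.symm⟩

end Transfer

section PageMaps

variable (X Y f) (S : 𝒯)

/-- The maps `[Σ^t D_s, S] ⟶ [Σ^t C_s, S]` that `f` induces between the first pages for
`H = [-, S]`. -/
noncomputable def cohMap (p : ℤ × ℤ) : (Y.cohCouple S).E p →+ (X.cohCouple S).E p :=
  Preadditive.leftComp S ((altMap f p.1)⟦p.2⟧')

/-- The maps `[S, Σ^t C_s] ⟶ [S, Σ^t D_s]` that `f` induces between the first pages for
`H = [S, -]`. -/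
noncomputable def homMap (p : ℤ × ℤ) : (X.homCouple S).E p →+ (Y.homCouple S).E p :=
  Preadditive.rightComp S ((altMap f p.1)⟦p.2⟧')

variable {X Y f} {S}

lemma nonneg_of_nontrivial_cohCouple_E {s t : ℤ} (h : Nontrivial ((X.cohCouple S).E (s, t))) :
    0 ≤ s := by
  by_contra! hs
  obtain ⟨x, y, hxy⟩ := h
  exact hxy (((shiftFunctor 𝒯 t).map_isZero (isZero_altComplex_X C hs)).eq_of_src x y)

lemma nonneg_of_nontrivial_homCouple_E {s t : ℤ} (h : Nontrivial ((X.homCouple S).E (s, t))) :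
    0 ≤ s := by
  by_contra! hs
  obtain ⟨x, y, hxy⟩ := h
  exact hxy (((shiftFunctor 𝒯 t).map_isZero (isZero_altComplex_X C hs)).eq_of_tgt x y)

lemma preservesDiff_one_cohMap : ExactCouple.PreservesDiff (X.cohMap Y f S) 1 le_rfl := by
  rintro ⟨s, t⟩ ⟨s', t'⟩ h (x : ((altComplex D).X s)⟦t⟧ ⟶ S) y hxy
  obtain rfl : t = t' := by simpa [cohGrading] using congrArg Prod.snd h
  obtain rfl := (cohCouple_diffRel_one_iff h x y).1 hxy
  refine (cohCouple_diffRel_one_iff h _ _).2 ?_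
  change _ ≫ (altMap f s)⟦t⟧' ≫ x = (altMap f s')⟦t⟧' ≫ _
  rw [← Functor.map_comp_assoc, ← Functor.map_comp_assoc, altMap_comm]

lemma preservesDiff_one_homMap : ExactCouple.PreservesDiff (X.homMap Y f S) 1 le_rfl := by
  rintro ⟨s', t'⟩ ⟨s, t⟩ h (x : S ⟶ ((altComplex C).X s')⟦t'⟧) y hxy
  obtain rfl : t' = t := by simpa [homGrading] using congrArg Prod.snd h
  obtain rfl := (homCouple_diffRel_one_iff h x y).1 hxy
  refine (homCouple_diffRel_one_iff h _ _).2 ?_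
  change (x ≫ (altMap f s')⟦t'⟧') ≫ _ = _ ≫ (altMap f s)⟦t'⟧'
  rw [assoc, assoc, ← Functor.map_comp, ← Functor.map_comp, altMap_comm]

variable {k : ℕ} (H : ∀ (N : ℕ) (hN : 2 ≤ N) (i : ℕ), N < k → 0 ∈ X.todaBracket Y f N hN i)
include H

lemma preservesDiff_cohMap {r : ℤ} (hr : 1 ≤ r) (hk : r < k) :
    ExactCouple.PreservesDiff (X.cohMap Y f S) r hr := by
  induction r, hr using Int.leInduction with
  | base => exact preservesDiff_one_cohMap
  | succ r hr ih =>
    refine (ih (by omega)).succ ?_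
    rintro ⟨s, t⟩ ⟨s', t'⟩ h x y hx - hxy
    have hs : s + (r + 1) = s' := congrArg Prod.fst h
    have ht : t + r = t' := by simpa [cohGrading] using congrArg Prod.snd h
    lift r to ℕ using by omega
    obtain ⟨U, V, φ, hφ⟩ := exists_commNextAttach_of_zero_mem_todaBracket (N := r + 1) (by omega)
      (H _ _ · (by omega)) (nonneg_of_nontrivial_cohCouple_E hx) (m := s + r) (s' := s')
      (by omega) (by omega) (by push_cast; omega)
    have diffRel_iff {Z : SimplicialObject 𝒯} {X : Totalization Z} := cohCouple_diffRel_iff (X := X)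
      (S := S) (m := s + r) (n := t - s) (by omega) h (by omega) (by omega) (by omega) (by omega)
    obtain ⟨a, ha, rfl⟩ := (diffRel_iff x y).1 hxy
    refine (diffRel_iff _ _).2 ?_
    exact hφ.exists_desc _ _ ha

lemma preservesDiff_homMap {r : ℤ} (hr : 1 ≤ r) (hk : r < k) :
    ExactCouple.PreservesDiff (X.homMap Y f S) r hr := by
  induction r, hr using Int.leInduction with
  | base => exact preservesDiff_one_homMap
  | succ r hr ih =>
    refine (ih (by omega)).succ ?_
    rintro ⟨s', t'⟩ ⟨s, t⟩ h x y - hy hxy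
    have hs : s + (r + 1) = s' := by
      have := congrArg Prod.fst h
      dsimp [homGrading] at this
      omega
    have ht : t + r = t' := by
      have := congrArg Prod.snd h
      dsimp [homGrading] at this
      omega
    lift r to ℕ using by omega
    obtain ⟨U, V, φ, hφ⟩ := exists_commNextAttach_of_zero_mem_todaBracket (N := r + 1) (by omega)
      (H _ _ · (by omega)) (nonneg_of_nontrivial_homCouple_E hy) (m := s + r) (s' := s')
      (by omega) (by omega) (by push_cast; omega)
    have diffRel_iff {Z : SimplicialObject 𝒯} {X : Totalization Z} := homCouple_diffRel_iff (X := X)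
      (S := S) (m := s + r) (n := t - s) (by omega) h (by omega) (by omega) (by omega) (by omega)
    obtain ⟨a, ha, rfl⟩ := (diffRel_iff x y).1 hxy
    refine (diffRel_iff _ _).2 ?_
    exact hφ.exists_lift _ _ ha

variable (S)

/-- The maps of pages for `H = [-, S]`. -/
noncomputable def cohPageMaps : X.CohPageMaps Y f S k where
  hom _ hr hk := (preservesDiff_cohMap H hr hk).pageMap
  hom_one hk n t x := (preservesDiff_cohMap H le_rfl hk).pageMap_pageOneIso ((n : ℤ), t) x
  comm r hr hk p := (preservesDiff_cohMap H hr (by omega)).homologyMap_pageMap_iso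
    (preservesDiff_cohMap H (r := r + 1) (by omega) hk) rfl p

/-- The maps of pages for `H = [S, -]`. -/
noncomputable def homPageMaps : X.HomPageMaps Y f S k where
  hom _ hr hk := (preservesDiff_homMap H hr hk).pageMap
  hom_one hk n t x := (preservesDiff_homMap H le_rfl hk).pageMap_pageOneIso ((n : ℤ), t) x
  comm r hr hk p := (preservesDiff_homMap H hr (by omega)).homologyMap_pageMap_iso
    (preservesDiff_homMap H (r := r + 1) (by omega) hk) rfl p

end PageMaps

section Convergence

variable (X)

lemma toTot_eq (s : ℤ) : X.toTot s = toSigma X.skel s ≫ X.incl := by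
  match s with
  | Int.ofNat n => exact congrArg (· ≫ X.incl) (toSigma_natCast X.skel n).symm
  | Int.negSucc n => exact (X.isZero_skel _ (Int.negSucc_lt_zero n)).eq_of_src _ _

lemma toSigma_oneSubShift {s s' : ℤ} (h : s + 1 = s') :
    toSigma X.skel s ≫ oneSubShift X.skel =
      toSigma X.skel s - X.skel.map (homOfLE (show s ≤ s' by omega)) ≫ toSigma X.skel s' := by
  subst h
  obtain hs | hs := lt_or_ge s 0
  · exact (X.isZero_skel s hs).eq_of_src _ _
  · lift s to ℕ using hs
    rw [toSigma_natCast, ι_oneSubShift, ← toSigma_natCast X.skel (s + 1)]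
    rfl

lemma map_toTot {s s' : ℤ} (h : s ≤ s') : X.skel.map (homOfLE h) ≫ X.toTot s' = X.toTot s := by
  induction s', h using Int.leInduction with
  | base => simp only [homOfLE_refl, CategoryTheory.Functor.map_id, id_comp]
  | succ j hj ih =>
    have hzero : oneSubShift X.skel ≫ X.incl = 0 := comp_distTriang_mor_zero₁₂ _ X.distinguished_tot
    have hstep : X.skel.map (homOfLE (show j ≤ j + 1 by omega)) ≫ X.toTot (j + 1) = X.toTot j := by
      rw [toTot_eq, toTot_eq, eq_comm, ← sub_eq_zero, ← assoc, ← Preadditive.sub_comp,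
        ← X.toSigma_oneSubShift rfl, assoc, hzero, comp_zero]
    rw [← homOfLE_comp hj (show j ≤ j + 1 by omega), Functor.map_comp, assoc, hstep, ih]

lemma skelShift_toTot {s s' : ℤ} (h : s ≤ s') (n : ℤ) :
    X.skelShift h n ≫ (X.toTot s')⟦n⟧' = (X.toTot s)⟦n⟧' := by
  rw [skelShift, ← Functor.map_comp, map_toTot]

section Milnor

variable (S : 𝒯) (n : ℤ)

/-- The restriction `[Σ^n ∐ T_m, S] ⟶ ∏ [Σ^n T_{m-1}, S]`, which is bijective as `T_{-1} = 0`. -/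
noncomputable def sigmaRestrict :
    ((∐ fun n : ℕ ↦ X.skel.obj n)⟦n⟧ ⟶ S) →+ ∀ m : ℕ, (X.cohCouple S).A m n :=
  AddMonoidHom.pi fun m : ℕ ↦ Preadditive.leftComp S ((toSigma X.skel ((m : ℤ) - 1))⟦n⟧')

/-- The restriction `[Σ^n Tot, S] ⟶ ∏ [Σ^n T_{m-1}, S]`. -/
noncomputable def totRestrict : (X.tot⟦n⟧ ⟶ S) →+ ∀ m : ℕ, (X.cohCouple S).A m n :=
  AddMonoidHom.pi fun m : ℕ ↦ Preadditive.leftComp S ((X.toTot ((m : ℤ) - 1))⟦n⟧')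

lemma toSigma_shift_comp_eq_iff {s : ℤ} {m : ℕ} (h : m = s)
    {w : (∐ fun n : ℕ ↦ X.skel.obj n)⟦n⟧ ⟶ S} {b : (X.skel.obj s)⟦n⟧ ⟶ S} :
    (toSigma X.skel s)⟦n⟧' ≫ w = b ↔
      (Sigma.ι (fun n : ℕ ↦ X.skel.obj n) m)⟦n⟧' ≫ w = X.skelShift h.le n ≫ b := by
  subst h
  rw [toSigma_natCast, skelShift_refl, id_comp]

lemma sigmaRestrict_injective : Function.Injective (X.sigmaRestrict S n) := by
  intro w w' hw
  rw [← cancel_epi (sigmaComparison (shiftFunctor 𝒯 n) _)]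
  refine Sigma.hom_ext _ _ fun m ↦ ?_
  have hm : (m : ℤ) = ((m + 1 : ℕ) : ℤ) - 1 := by omega
  rw [ι_comp_sigmaComparison_assoc, ι_comp_sigmaComparison_assoc,
    (X.toSigma_shift_comp_eq_iff S n hm).1 (congrFun hw (m + 1))]
  exact ((X.toSigma_shift_comp_eq_iff S n hm).1 rfl).symm

lemma sigmaRestrict_surjective : Function.Surjective (X.sigmaRestrict S n) := by
  intro a
  have hm (m : ℕ) : (m : ℤ) = ((m + 1 : ℕ) : ℤ) - 1 := by omega
  refine ⟨inv (sigmaComparison (shiftFunctor 𝒯 n) _) ≫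
    Sigma.desc fun m ↦ X.skelShift (hm m).le n ≫ a (m + 1), funext fun m ↦ ?_⟩
  obtain _ | m := m
  · exact (X.isZero_shift_skel (by omega) n).eq_of_src _ _
  · refine (X.toSigma_shift_comp_eq_iff S n (hm m)).2 ?_
    rw [← assoc, map_ι_comp_inv_sigmaComparison]
    exact Sigma.ι_desc _ _

/-- Maps out of the coproduct of the skeleta, as families of maps out of the skeleta. -/
noncomputable def sigmaRestrictEquiv :
    ((∐ fun n : ℕ ↦ X.skel.obj n)⟦n⟧ ⟶ S) ≃+ ∀ m : ℕ, (X.cohCouple S).A m n :=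
  AddEquiv.ofBijective (X.sigmaRestrict S n)
    ⟨X.sigmaRestrict_injective S n, X.sigmaRestrict_surjective S n⟩

/-- The map `∏ [Σ^{n+1} T_{m-1}, S] ⟶ [Σ^n Tot, S]` of the Milnor sequence. -/
noncomputable def prodToTot : (∀ m : ℕ, (X.cohCouple S).A m (n + 1)) →+ (X.tot⟦n⟧ ⟶ S) :=
  (Preadditive.leftComp S (connShift X.conn n)).comp
    (X.sigmaRestrictEquiv S (n + 1)).symm.toAddMonoidHom

lemma limDiff_sigmaRestrict (w : (∐ fun n : ℕ ↦ X.skel.obj n)⟦n⟧ ⟶ S) :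
    (X.cohCouple S).limDiff n (X.sigmaRestrict S n w) =
      X.sigmaRestrict S n ((oneSubShift X.skel)⟦n⟧' ≫ w) := by
  funext m
  change (toSigma X.skel _)⟦n⟧' ≫ w - X.skelShift _ n ≫ (toSigma X.skel _)⟦n⟧' ≫ w =
    (toSigma X.skel _)⟦n⟧' ≫ (oneSubShift X.skel)⟦n⟧' ≫ w
  rw [← Functor.map_comp_assoc (f := toSigma X.skel ((m : ℤ) - 1)),
    X.toSigma_oneSubShift (s' := ((m + 1 : ℕ) : ℤ) - 1) (by omega), Functor.map_sub,
    Preadditive.sub_comp, Functor.map_comp, assoc]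
  rfl

lemma sigmaRestrict_incl (x : X.tot⟦n⟧ ⟶ S) :
    X.sigmaRestrict S n (X.incl⟦n⟧' ≫ x) = X.totRestrict S n x := by
  funext m
  change (toSigma X.skel _)⟦n⟧' ≫ X.incl⟦n⟧' ≫ x = (X.toTot _)⟦n⟧' ≫ x
  rw [toTot_eq, Functor.map_comp, assoc]

lemma exact_limDiff_prodToTot :
    Function.Exact ((X.cohCouple S).limDiff (n + 1)) (X.prodToTot S n) := by
  refine (Function.Exact.iff_of_ladder_addEquiv (e₁ := X.sigmaRestrictEquiv S (n + 1))
    (e₂ := X.sigmaRestrictEquiv S (n + 1)) (e₃ := AddEquiv.refl _) ?_ ?_).2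
    (exact_leftComp_shift₁_connShift S X.distinguished_tot n)
  · exact AddMonoidHom.ext (X.limDiff_sigmaRestrict S (n + 1))
  · ext w
    exact congrArg (connShift X.conn n ≫ ·) ((X.sigmaRestrictEquiv S (n + 1)).symm_apply_apply w)

lemma exact_prodToTot_totRestrict : Function.Exact (X.prodToTot S n) (X.totRestrict S n) := by
  refine (Function.Exact.iff_of_ladder_addEquiv (e₁ := X.sigmaRestrictEquiv S (n + 1))
    (e₂ := AddEquiv.refl _) (e₃ := X.sigmaRestrictEquiv S n) ?_ ?_).2
    (exact_leftComp_connShift_shift₂ S X.distinguished_tot n)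
  · ext w
    exact congrArg (connShift X.conn n ≫ ·) ((X.sigmaRestrictEquiv S (n + 1)).symm_apply_apply w)
  · exact AddMonoidHom.ext fun x ↦ (X.sigmaRestrict_incl S n x).symm

lemma exact_totRestrict_limDiff :
    Function.Exact (X.totRestrict S n) ((X.cohCouple S).limDiff n) := by
  refine (Function.Exact.iff_of_ladder_addEquiv (e₁ := AddEquiv.refl _)
    (e₂ := X.sigmaRestrictEquiv S n) (e₃ := X.sigmaRestrictEquiv S n) ?_ ?_).2
    (exact_leftComp_shift₂₁ S X.distinguished_tot n)
  · exact AddMonoidHom.ext fun x ↦ (X.sigmaRestrict_incl S n x).symm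
  · exact AddMonoidHom.ext (X.limDiff_sigmaRestrict S n)

lemma convergesConditionallyToLimit_cohCouple :
    (X.cohCouple S).ConvergesConditionallyToLimit (fun n ↦ (X.tot⟦n⟧ ⟶ S))
      (fun σ n ↦ Preadditive.leftComp S ((X.toTot (σ - 1))⟦n⟧')) where
  colim_eq_zero σ n a :=
    ⟨min σ 0, min_le_left _ _, (X.isZero_shift_skel (by omega) n).eq_of_src _ _⟩
  compat _ n _ := (assoc _ _ _).symm.trans (congrArg (· ≫ _) (X.skelShift_toTot _ n))
  lim_surjective n a ha := by
    obtain ⟨x, rfl⟩ := (X.exact_totRestrict_limDiff S n a).1 ha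
    exact ⟨x, fun m ↦ rfl⟩
  ker_eq_limOne n := by
    obtain ⟨l, hl, hrange⟩ := exists_injective_quotient_of_exact (X.exact_limDiff_prodToTot S n)
      (X.exact_prodToTot_totRestrict S n)
    exact ⟨l, hl, fun x ↦ (hrange x).trans funext_iff⟩

end Milnor

variable {S : 𝒯} {n : ℤ}

lemma limDiff_homCouple (a : ∀ m : ℕ, (X.homCouple S).A m n) :
    (X.homCouple S).limDiff n a = a := by
  funext m
  have hzero : a (m + 1) = 0 := (X.isZero_shift_skel (by omega) n).eq_of_tgt _ _
  exact (congrArg (a m - (X.homCouple S).i _ n ·) hzero).trans (by rw [map_zero, sub_zero])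

variable (S) in
lemma convergesConditionallyToColimit_homCouple :
    (X.homCouple S).ConvergesConditionallyToColimit where
  lim_eq_zero n a b h := by rwa [limDiff_homCouple, limDiff_homCouple] at h
  limOne_eq_zero n a := ⟨a, X.limDiff_homCouple a⟩

lemma ι_incl (k : ℕ) : Sigma.ι (fun n : ℕ ↦ X.skel.obj n) k ≫ X.incl = X.toTot k := rfl

variable {X}

lemma exists_comp_toTot_eq (hS : IsCompactForCoproducts S) (x : S ⟶ X.tot⟦n⟧) :
    ∃ M : ℕ, ∀ s : ℤ, M ≤ s → ∃ a : S ⟶ (X.skel.obj s)⟦n⟧, a ≫ (X.toTot s)⟦n⟧' = x := by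
  obtain ⟨z, rfl⟩ := coyoneda_exact_connShift X.distinguished_tot n (b := x)
    (hS.eq_zero_of_comp_oneSubShift (by
      rw [assoc, connShift_comp_zero X.distinguished_tot, comp_zero]))
  obtain ⟨F, -, hz⟩ := hS.exists_eq_sum_components z
  refine ⟨F.sup id, fun s hs ↦ ⟨z ≫ (toStage X.skel s)⟦n⟧', ?_⟩⟩
  rw [assoc, hz, Preadditive.sum_comp, Preadditive.sum_comp]
  refine Finset.sum_congr rfl fun k hk ↦ ?_
  have hks : (k : ℤ) ≤ s := (Int.ofNat_le.2 (Finset.le_sup (f := id) hk)).trans hs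
  simp only [assoc, ← Functor.map_comp, reassoc_of% ι_toStage (T := X.skel) hks, map_toTot, ι_incl]

lemma exists_comp_skelShift_eq_zero (hS : IsCompactForCoproducts S) {s : ℤ}
    {a : S ⟶ (X.skel.obj s)⟦n⟧} (ha : a ≫ (X.toTot s)⟦n⟧' = 0) :
    ∃ (s' : ℤ) (h : s ≤ s'), a ≫ X.skelShift h n = 0 := by
  rw [toTot_eq, Functor.map_comp, ← assoc] at ha
  obtain ⟨y, hy⟩ := coyoneda_exact_shift X.distinguished_tot n ha
  exact hS.exists_comp_map_eq_zero hy

variable (X)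

lemma isColimit_homCouple (hS : IsCompactForCoproducts S) :
    (X.homCouple S).IsColimit (fun n ↦ (S ⟶ X.tot⟦n⟧))
      (fun σ n ↦ Preadditive.rightComp S ((X.toTot (-σ))⟦n⟧')) where
  compat _ n a := (assoc _ _ _).trans (congrArg (a ≫ ·) (X.skelShift_toTot _ n))
  surjective n x := by
    obtain ⟨M, hM⟩ := exists_comp_toTot_eq hS x
    exact ⟨-M, hM _ (neg_neg _).ge⟩
  injective σ n a ha := by
    obtain ⟨s', h, hs'⟩ := exists_comp_skelShift_eq_zero hS ha
    obtain ⟨σ', rfl⟩ : ∃ σ', s' = -σ' := ⟨-s', (neg_neg s').symm⟩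
    exact ⟨σ', neg_le_neg_iff.1 h, hs'⟩

variable (S)

lemma isCohSkeletalSS : X.IsCohSkeletalSS S where
  isZero s t hs :=
    have : Subsingleton ((X.cohCouple S).E (s, t)) :=
      ⟨((shiftFunctor 𝒯 t).map_isZero (isZero_altComplex_X C hs)).eq_of_src⟩
    (X.cohCouple S).isZero_page_one (s, t)
  d_one n t x := by
    have h : (((n : ℕ) : ℤ), t) + cohGrading.shift 1 = (((n + 1 : ℕ) : ℤ), t) := by
      simp [cohGrading]
    refine ExactCouple.page_one_d_pageOneIso h ((cohCouple_diffRel_one_iff h _ _).2 ?_)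
    rw [altComplex_d_succ]
    rfl
  converges := X.convergesConditionallyToLimit_cohCouple S

lemma isHomSkeletalSS : X.IsHomSkeletalSS S where
  isZero s t hs :=
    have : Subsingleton ((X.homCouple S).E (s, t)) :=
      ⟨((shiftFunctor 𝒯 t).map_isZero (isZero_altComplex_X C hs)).eq_of_tgt⟩
    (X.homCouple S).isZero_page_one (s, t)
  d_one n t x := by
    have h : (((n + 1 : ℕ) : ℤ), t) + homGrading.shift 1 = (((n : ℕ) : ℤ), t) := by
      simp [homGrading]
    refine ExactCouple.page_one_d_pageOneIso h ((homCouple_diffRel_one_iff h _ _).2 ?_)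
    rw [altComplex_d_succ]
    rfl
  converges := X.convergesConditionallyToColimit_homCouple S
  abutment := X.isColimit_homCouple

end Convergence

end Totalization

end Triangulated

theorem mainTheorem3_general {𝒯 : Type u} [Category.{v} 𝒯] [Preadditive 𝒯] [HasZeroObject 𝒯]
    [HasShift 𝒯 ℤ] [∀ n : ℤ, (shiftFunctor 𝒯 n).Additive] [Pretriangulated 𝒯]
    [HasCoproductsOfShape ℕ 𝒯] {C D : SimplicialObject 𝒯}
    (X : Totalization C) (Y : Totalization D) (f : C ⟶ D) (S : 𝒯) :
    (X.IsCohSkeletalSS S ∧ Y.IsCohSkeletalSS S ∧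
      ∀ k : ℕ, (∀ (N : ℕ) (hN : 2 ≤ N) (i : ℕ), N < k → 0 ∈ X.todaBracket Y f N hN i) →
        Nonempty (X.CohPageMaps Y f S k)) ∧
    (X.IsHomSkeletalSS S ∧ Y.IsHomSkeletalSS S ∧
      ∀ k : ℕ, (∀ (N : ℕ) (hN : 2 ≤ N) (i : ℕ), N < k → 0 ∈ X.todaBracket Y f N hN i) →
        Nonempty (X.HomPageMaps Y f S k)) :=
  ⟨⟨X.isCohSkeletalSS S, Y.isCohSkeletalSS S, fun _ H ↦ ⟨Totalization.cohPageMaps S H⟩⟩,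
    ⟨X.isHomSkeletalSS S, Y.isHomSkeletalSS S, fun _ H ↦ ⟨Totalization.homPageMaps S H⟩⟩⟩

theorem mainTheorem3 {𝒯 : Type u} [Category.{v} 𝒯] [Preadditive 𝒯] [HasZeroObject 𝒯]
    [HasShift 𝒯 ℤ] [∀ n : ℤ, (shiftFunctor 𝒯 n).Additive] [Pretriangulated 𝒯]
    [IsTriangulated 𝒯] [HasCoproductsOfShape ℕ 𝒯] {C D : SimplicialObject 𝒯}
    (X : Totalization C) (Y : Totalization D) (f : C ⟶ D) (S : 𝒯) :
    (X.IsCohSkeletalSS S ∧ Y.IsCohSkeletalSS S ∧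
      Nonempty (X.CohPageMaps Y f S 2) ∧
      ∀ k : ℕ, 2 < k →
        (∀ (N : ℕ) (hN : 2 ≤ N) (i : ℕ), N < k → 0 ∈ X.todaBracket Y f N hN i) →
        Nonempty (X.CohPageMaps Y f S k)) ∧
    (X.IsHomSkeletalSS S ∧ Y.IsHomSkeletalSS S ∧
      Nonempty (X.HomPageMaps Y f S 2) ∧
      ∀ k : ℕ, 2 < k →
        (∀ (N : ℕ) (hN : 2 ≤ N) (i : ℕ), N < k → 0 ∈ X.todaBracket Y f N hN i) →
        Nonempty (X.HomPageMaps Y f S k)) := by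
  obtain ⟨⟨hX, hY, hcoh⟩, hX', hY', hhom⟩ := mainTheorem3_general X Y f S
  exact ⟨⟨hX, hY, hcoh 2 (by omega), fun k _ ↦ hcoh k⟩,
    hX', hY', hhom 2 (by omega), fun k _ ↦ hhom k⟩
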